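/- **Kinetic Poincaré inequality.** Let $d$ be the dimension, write $z=(t,x,v)\in\mathbb R\times\mathbb R^d\times\mathbb R^d$, and for $r>0$ let $$Q_r=Q_r^+:=(-r^2,0]\times B_{r^3}\times B_r,\qquad Q_r^-:=\{-3r^2<t<-2r^2,\ |x|<r^3,\ |v|<r\},\qquad \langle f\rangle_{Q_r^-}:=\frac1{|Q_r^-|}\int_{Q_r^-}f\,\mathrm dz .$$ There is $r\in(0,1)$ with $Q_r^-\subset Q_1$, depending on $d$ only, such that for every $\Lambda>0$ there is $C>0$, depending only on $\Lambda$ and $d$, so that the following holds. Let $A=A(t,x,v)$ be a measurable field of real symmetric $d\times d$ matrices on $Q_1$ with $-\Lambda|\xi|^2\le A(z)\xi\cdot\xi\le\Lambda|\xi|^2$ for all $\xi\in\mathbb R^d$ and almost every $z\in Q_1$ (no coercivity is assumed; in particular $0\le A\le\Lambda$ is allowed). Let $f\ge 0$ almost everywhere in $Q_1$ be a weak subsolution in $Q_1$ to $$\partial_t f+v\cdot\nabla_x f\le\nabla_v\cdot(A\nabla_v f),$$ that is, $f\in L^1(Q_1)$ has a weak velocity gradient $\nabla_v f\in L^1(Q_1;\mathbb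 R^d)$, and for all nonnegative $\varphi\in C_c^\infty(\mathring Q_1)$, where $\mathring Q_1$ is the interior of $Q_1$, $$-\int_{Q_1}f\,(\partial_t\varphi+v\cdot\nabla_x\varphi)\,\mathrm dz\le-\int_{Q_1}A\nabla_v f\cdot\nabla_v\varphi\,\mathrm dz .$$ Then $$\int_{Q_r^+}\bigl(f-\langle f\rangle_{Q_r^-}\bigr)_+\,\mathrm dz\le C\int_{Q_1}|\nabla_v f|\,\mathrm dz .$$ -/

import Mathlib

open MeasureTheory Set
open scoped ContDiff

noncomputable section

/-- The variables `z = (t, x, v)` with `t ∈ ℝ` and `x, v ∈ ℝ^d`. -/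
abbrev Phase (d : ℕ) : Type :=
  ℝ × EuclideanSpace ℝ (Fin d) × EuclideanSpace ℝ (Fin d)

/-- The kinetic cylinder `Q_r = (-r², 0] × B_{r³} × B_r`. -/
def kinCyl (d : ℕ) (r : ℝ) : Set (Phase d) :=
  Ioc (-r ^ 2) 0 ×ˢ (Metric.ball 0 (r ^ 3) ×ˢ Metric.ball 0 r)

/-- The past cylinder `Q_r^- = {-3r² < t < -2r², |x| < r³, |v| < r}`. -/
def pastCyl (d : ℕ) (r : ℝ) : Set (Phase d) :=
  Ioo (-3 * r ^ 2) (-2 * r ^ 2) ×ˢ (Metric.ball 0 (r ^ 3) ×ˢ Metric.ball 0 r)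

/-- Smooth test functions with compact support inside `U`. -/
structure IsTestFun {d : ℕ} (U : Set (Phase d)) (φ : Phase d → ℝ) : Prop where
  contDiff : ContDiff ℝ ∞ φ
  hasCompactSupport : HasCompactSupport φ
  tsupport_subset : tsupport φ ⊆ U

/-- The transport operator `∂_t φ + v · ∇_x φ` on differentiable functions: the derivative
at `(t, x, v)` in the direction `(1, v, 0)`. -/
def transport {d : ℕ} (φ : Phase d → ℝ) (z : Phase d) : ℝ :=
  fderiv ℝ φ z (1, z.2.2, 0)

/-- The classical velocity gradient `∇_v φ`. -/
def gradV {d : ℕ} (φ : Phase d → ℝ) (z : Phase d) : EuclideanSpace ℝ (Fin d) :=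
  gradient (fun w => φ (z.1, z.2.1, w)) z.2.2

/-- `g` is the weak velocity gradient `∇_v f` on `U`, both functions being integrable on `U`. -/
structure HasWeakGradV {d : ℕ} (U : Set (Phase d)) (f : Phase d → ℝ)
    (g : Phase d → EuclideanSpace ℝ (Fin d)) : Prop where
  integrable_fun : IntegrableOn f U
  integrable_grad : IntegrableOn g U
  integral_eq : ∀ φ : Phase d → ℝ, IsTestFun U φ →
    ∫ z in U, f z • gradV φ z = -∫ z in U, φ z • g z

/-- A measurable field of symmetric matrices on `U` with `-Λ ≤ A ≤ Λ` almost everywhere,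
in the sense of quadratic forms. -/
structure IsBoundedCoeff {d : ℕ} (U : Set (Phase d)) (Λ : ℝ)
    (A : Phase d → Matrix (Fin d) (Fin d) ℝ) : Prop where
  aemeasurable : ∀ i j, AEMeasurable (fun z => A z i j) (volume.restrict U)
  isSymm : ∀ᵐ z ∂(volume.restrict U), (A z).IsSymm
  bound : ∀ᵐ z ∂(volume.restrict U), ∀ ξ : EuclideanSpace ℝ (Fin d),
    |inner ℝ ((A z).toEuclideanLin ξ) ξ| ≤ Λ * ‖ξ‖ ^ 2

/-- `f`, with weak velocity gradient `g`, is a weak subsolution on `U` to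
`∂_t f + v · ∇_x f ≤ ∇_v · (A ∇_v f)`, that is, the inequality holds when tested against
every nonnegative test function. -/
structure IsWeakSubsolution {d : ℕ} (U : Set (Phase d))
    (A : Phase d → Matrix (Fin d) (Fin d) ℝ) (f : Phase d → ℝ)
    (g : Phase d → EuclideanSpace ℝ (Fin d)) : Prop where
  weakGrad : HasWeakGradV U f g
  integral_le : ∀ φ : Phase d → ℝ, IsTestFun U φ → (∀ z, 0 ≤ φ z) →
    -∫ z in U, f z * transport φ z ≤
      -∫ z in U, inner ℝ ((A z).toEuclideanLin (g z)) (gradV φ z)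

end

noncomputable section

/-! The difficulty is that a subsolution gives no pointwise control, and only `∇_v f` in L¹ may
appear on the right. The positive part is an integral of `f - c` over a superlevel set `E` of the
upper cylinder, so it suffices to compare the mass of `f` on an arbitrary measurable `E` with its
mass on the past cylinder, proportionally to volumes. Replacing the two indicators by smooth `ψ` and
`χ`, one needs a comparison whose constant uses only `0 ≤ ψ, χ ≤ 1` and the supports, never
derivatives of `ψ` or `χ`; this is `exists_comparison`, and the theorem follows by a limit.

The comparison passes through a fixed smooth profile `ζ(x,v) = a(x) b(v)`. Each point is joined to
the points at time distance `S` by kinetic trajectories with a control `w = (y,u)`. Transporting `ψ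
ζ` along them gives, for each control and each parameter `σ`, a test function `bridge`. Averaged
over `w`, it equals `ψ ∫ζ` at `σ = 0`, and at `σ = 1` the time marginal of `ψ` shifted by `S`, times
`ζ`. Its `σ`-derivative is `3Sσ²` times transport plus a velocity derivative
(`fderiv_bridge_sigma_eq`). The velocity derivative is moved onto `f` and produces `∇_v f`; the
transport is handled by the subsolution inequality, which leaves `σ² ∇_v(bridge) · A ∇_v f`.

That last term still differentiates `ψ`. The trajectories are chosen so that the map from the
control to the starting position and velocity can be inverted at the cost of the weight `σ²` already
present: a velocity displacement of size `σ²` is a bounded displacement of the control, up to a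
derivative of `ζ` (`fderiv_bridge_control_eq`). Averaging over `w` annihilates the control
derivative, so only `ζ` is differentiated. This yields `bridge_inequality`, whose direction is set
by the sign of `S`: for `S > 0` it bounds the mass of `ψ` by a `ζ`-mass at earlier times, for `S <
0` it bounds a `ζ`-mass at later times by the mass of `χ`.

It remains to compare `ζ`-masses weighted by two time densities, the earlier one coming from `χ`.
Testing with `k(t) a(x) b(v)`, where `k'` is the balanced difference of the densities, does this,
except for the term `v · ∇a b`. Since `b` is chosen with `v b(v) = ∇Z(v)`, that term too integrates
by parts in `v` into `∇_v f` (`time_inequality`). -/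

/-- Positions and velocities. -/
abbrev Vel (d : ℕ) : Type := EuclideanSpace ℝ (Fin d)

variable {d : ℕ}

/-! ### Critical kinetic trajectories and the densities they carry. -/

/-- The point at which the critical kinetic trajectory with control `w`, which passes through `z`
at parameter `σ`, starts at parameter `0`. -/
def startPt (S σ : ℝ) (w : Vel d × Vel d) (z : Phase d) : Phase d :=
  (z.1 + S * σ ^ 3,
    z.2.1 + (S * σ ^ 3) • z.2.2 + (S * (σ ^ 4 - 2 * σ ^ 5)) • w.2
      + ((5 * σ ^ 4 - 8 * σ ^ 5) / 3) • w.1,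
    z.2.2 + (4 * σ - 5 * σ ^ 2) • w.2 + (20 / (3 * S) * (σ - σ ^ 2)) • w.1)

/-- Position and velocity, at parameter `1`, of the critical kinetic trajectory with control `w`
that starts at `z`. -/
def endPt (S : ℝ) (w : Vel d × Vel d) (z : Phase d) : Vel d × Vel d :=
  (z.2.1 - S • z.2.2 + w.1, z.2.2 + w.2)

/-- The derivative in `σ` of the starting velocity along critical trajectories. -/
def steer (S : ℝ) (p : (Vel d × Vel d) × ℝ) : Vel d :=
  (4 - 10 * p.2) • p.1.2 + (20 / (3 * S) * (1 - 2 * p.2)) • p.1.1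

/-- The density carried by critical trajectories from `ψ` to `ζ`. -/
def bridge (ψ : Phase d → ℝ) (ζ : Vel d × Vel d → ℝ) (S : ℝ)
    (q : ((Vel d × Vel d) × ℝ) × Phase d) : ℝ :=
  ψ (startPt S q.1.2 q.1.1 q.2) * ζ (endPt S q.1.1 (startPt S q.1.2 q.1.1 q.2))

theorem contDiff_startPt (S : ℝ) : ContDiff ℝ ∞
    (fun q : ((Vel d × Vel d) × ℝ) × Phase d => startPt S q.1.2 q.1.1 q.2) := by
  unfold startPt; fun_prop

theorem contDiff_endPt (S : ℝ) : ContDiff ℝ ∞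
    (fun q : ((Vel d × Vel d) × ℝ) × Phase d =>
      endPt S q.1.1 (startPt S q.1.2 q.1.1 q.2)) := by
  unfold endPt startPt; fun_prop

theorem continuous_steer (S : ℝ) : Continuous (steer (d := d) S) := by
  unfold steer; fun_prop

theorem contDiff_bridge {ψ : Phase d → ℝ} {ζ : Vel d × Vel d → ℝ} (hψ : ContDiff ℝ ∞ ψ)
    (hζ : ContDiff ℝ ∞ ζ) (S : ℝ) : ContDiff ℝ ∞ (bridge ψ ζ S) :=
  (hψ.comp (contDiff_startPt S)).mul (hζ.comp (contDiff_endPt S))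

theorem hasDerivAt_mul_comp {X Y : Type*} [NormedAddCommGroup X] [NormedSpace ℝ X]
    [NormedAddCommGroup Y] [NormedSpace ℝ Y] {ψ : X → ℝ} {ζ : Y → ℝ} (hψ : Differentiable ℝ ψ)
    (hζ : Differentiable ℝ ζ) {a : ℝ → X} {b : ℝ → Y} {a₀ a' : X} {b₀ b' : Y} {τ : ℝ}
    (ha : HasDerivAt a a' τ) (hb : HasDerivAt b b' τ) (ha₀ : a τ = a₀) (hb₀ : b τ = b₀) :
    HasDerivAt (fun s => ψ (a s) * ζ (b s))
      (fderiv ℝ ψ a₀ a' * ζ b₀ + ψ a₀ * fderiv ℝ ζ b₀ b') τ := by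
  subst ha₀ hb₀
  exact ((hψ _).hasFDerivAt.comp_hasDerivAt τ ha).mul ((hζ _).hasFDerivAt.comp_hasDerivAt τ hb)

theorem fderiv_apply_eq_of_hasDerivAt {X : Type*} [NormedAddCommGroup X] [NormedSpace ℝ X]
    {F : X → ℝ} (hF : Differentiable ℝ F) {c : ℝ → X} {c₀ c' : X} {τ l : ℝ}
    (hc : HasDerivAt c c' τ) (hc₀ : c τ = c₀) (h : HasDerivAt (fun s => F (c s)) l τ) :
    fderiv ℝ F c₀ c' = l := by
  subst hc₀
  exact ((hF _).hasFDerivAt.comp_hasDerivAt τ hc).unique h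

theorem HasDerivAt.fst_comp {X Y : Type*} [NormedAddCommGroup X] [NormedSpace ℝ X]
    [NormedAddCommGroup Y] [NormedSpace ℝ Y] {c : ℝ → X × Y} {c' : X × Y} {τ : ℝ}
    (h : HasDerivAt c c' τ) : HasDerivAt (fun s => (c s).1) c'.1 τ :=
  (ContinuousLinearMap.fst ℝ X Y).hasFDerivAt.comp_hasDerivAt τ h

theorem HasDerivAt.snd_comp {X Y : Type*} [NormedAddCommGroup X] [NormedSpace ℝ X]
    [NormedAddCommGroup Y] [NormedSpace ℝ Y] {c : ℝ → X × Y} {c' : X × Y} {τ : ℝ}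
    (h : HasDerivAt c c' τ) : HasDerivAt (fun s => (c s).2) c'.2 τ :=
  (ContinuousLinearMap.snd ℝ X Y).hasFDerivAt.comp_hasDerivAt τ h

/-! ### Derivatives of the bridge in the parameter, the phase variable and the control. -/

section Derivatives

variable {ψ : Phase d → ℝ} {ζ : Vel d × Vel d → ℝ}

/-- The position polynomials in `startPt` are those for which `z` moves kinetically in the time `-S
σ³`. Hence the starting position varies, beyond free transport, exactly by `S σ³` times the
variation `steer` of the starting velocity. -/
theorem fderiv_bridge_sigma (hψ : ContDiff ℝ ∞ ψ) (hζ : ContDiff ℝ ∞ ζ) (S : ℝ)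
    (w : Vel d × Vel d) (σ : ℝ) (z : Phase d) (hS : S ≠ 0) :
    fderiv ℝ (bridge ψ ζ S) ((w, σ), z) ((0, 1), 0) =
      fderiv ℝ ψ (startPt S σ w z) (3 * S * σ ^ 2,
        (3 * S * σ ^ 2) • z.2.2 + (S * σ ^ 3) • steer S (w, σ), steer S (w, σ))
        * ζ (endPt S w (startPt S σ w z))
      + ψ (startPt S σ w z) * fderiv ℝ ζ (endPt S w (startPt S σ w z))
        ((3 * S * σ ^ 2) • z.2.2 + (S * σ ^ 3 - S) • steer S (w, σ), steer S (w, σ)) := by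
  have hc : HasDerivAt (fun s : ℝ => (((w, s), z) : ((Vel d × Vel d) × ℝ) × Phase d))
      ((0, 1), 0) σ :=
    ((hasDerivAt_const σ w).prodMk (hasDerivAt_id σ)).prodMk (hasDerivAt_const σ z)
  refine fderiv_apply_eq_of_hasDerivAt
    ((contDiff_bridge hψ hζ S).differentiable (by simp)) hc rfl ?_
  have p2 : HasDerivAt (fun s : ℝ => s ^ 2) (2 * σ) σ := by simpa using hasDerivAt_pow 2 σ
  have p3 : HasDerivAt (fun s : ℝ => s ^ 3) (3 * σ ^ 2) σ := by simpa using hasDerivAt_pow 3 σ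
  have p4 : HasDerivAt (fun s : ℝ => s ^ 4) (4 * σ ^ 3) σ := by simpa using hasDerivAt_pow 4 σ
  have p5 : HasDerivAt (fun s : ℝ => s ^ 5) (5 * σ ^ 4) σ := by simpa using hasDerivAt_pow 5 σ
  have p1 := hasDerivAt_id σ
  have hx := ((((p3.const_mul S).smul_const z.2.2).const_add z.2.1).add
    (((p4.sub (p5.const_mul 2)).const_mul S).smul_const w.2)).add
    ((((p4.const_mul 5).sub (p5.const_mul 8)).div_const 3).smul_const w.1)
  have hv := ((((p1.const_mul 4).sub (p2.const_mul 5)).smul_const w.2).const_add z.2.2).add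
    (((p1.sub p2).const_mul (20 / (3 * S))).smul_const w.1)
  have ht := (p3.const_mul S).const_add z.1
  have ha : HasDerivAt (fun s => startPt S s w z) (3 * S * σ ^ 2,
        (3 * S * σ ^ 2) • z.2.2 + (S * σ ^ 3) • steer S (w, σ), steer S (w, σ)) σ := by
    convert! ht.prodMk (hx.prodMk hv) using 2
    · ring
    · congr 1
      · simp only [steer, smul_add, smul_smul]
        rw [add_assoc]
        congr 1
        · congr 1; ring
        · congr 2
          · ring
          · field_simp; ring
      · simp only [steer]
        congr 2
        ring
  have hb : HasDerivAt (fun s => endPt S w (startPt S s w z))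
      ((3 * S * σ ^ 2) • z.2.2 + (S * σ ^ 3 - S) • steer S (w, σ), steer S (w, σ)) σ := by
    have h1 := ha.snd_comp.fst_comp
    have h2 := ha.snd_comp.snd_comp
    convert! ((h1.sub (h2.const_smul S)).add_const w.1).prodMk (h2.add_const w.2) using 2
    simp only [sub_smul]; abel
  exact hasDerivAt_mul_comp (hψ.differentiable (by simp)) (hζ.differentiable (by simp)) ha hb rfl rfl

/-- For fixed control and parameter the start depends on `z` through free transport over time `S
σ³`, and the end through free transport over `S σ³ - S`; the end does not see the time component. -/
theorem fderiv_bridge_phase (hψ : ContDiff ℝ ∞ ψ) (hζ : ContDiff ℝ ∞ ζ) (S : ℝ)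
    (w : Vel d × Vel d) (σ : ℝ) (z h : Phase d) :
    fderiv ℝ (bridge ψ ζ S) ((w, σ), z) (0, h) =
      fderiv ℝ ψ (startPt S σ w z) (h.1, h.2.1 + (S * σ ^ 3) • h.2.2, h.2.2)
        * ζ (endPt S w (startPt S σ w z))
      + ψ (startPt S σ w z) * fderiv ℝ ζ (endPt S w (startPt S σ w z))
        (h.2.1 + (S * σ ^ 3 - S) • h.2.2, h.2.2) := by
  have p1 := (hasDerivAt_id (0 : ℝ)).smul_const h
  have hz : HasDerivAt (fun s : ℝ => z + s • h) h 0 := by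
    simpa using p1.const_add z
  have hc : HasDerivAt (fun s : ℝ => (((w, σ), z + s • h) : ((Vel d × Vel d) × ℝ) × Phase d))
      (0, h) 0 := (hasDerivAt_const 0 (w, σ)).prodMk hz
  refine fderiv_apply_eq_of_hasDerivAt
    ((contDiff_bridge hψ hζ S).differentiable (by simp)) hc (by simp) ?_
  have ha : HasDerivAt (fun s : ℝ => startPt S σ w (z + s • h))
      (h.1, h.2.1 + (S * σ ^ 3) • h.2.2, h.2.2) 0 :=
    (hz.fst_comp.add_const _).prodMk ((((hz.snd_comp.fst_comp.add (hz.snd_comp.snd_comp.const_smul (S * σ ^ 3))).add_const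
      _).add_const _).prodMk ((hz.snd_comp.snd_comp.add_const _).add_const _))
  have hb : HasDerivAt (fun s : ℝ => endPt S w (startPt S σ w (z + s • h)))
      (h.2.1 + (S * σ ^ 3 - S) • h.2.2, h.2.2) 0 := by
    have h1 := ha.snd_comp.fst_comp
    have h2 := ha.snd_comp.snd_comp
    convert! ((h1.sub (h2.const_smul S)).add_const w.1).prodMk (h2.add_const w.2) using 2
    simp only [sub_smul]; abel
  exact hasDerivAt_mul_comp (hψ.differentiable (by simp)) (hζ.differentiable (by simp)) ha hb
    (by rw [zero_smul, add_zero]) (by rw [zero_smul, add_zero])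

theorem hasDerivAt_control_line (w k : Vel d × Vel d) (x : Vel d) (α β : ℝ) :
    HasDerivAt (fun s : ℝ => x + α • (w + s • k).2 + β • (w + s • k).1)
      (α • k.2 + β • k.1) 0 := by
  have hw : HasDerivAt (fun s : ℝ => w + s • k) k 0 := by
    simpa using ((hasDerivAt_id (0 : ℝ)).smul_const k).const_add w
  exact ((hw.snd_comp.const_smul α).const_add x).add (hw.fst_comp.const_smul β)

theorem fderiv_bridge_control (hψ : ContDiff ℝ ∞ ψ) (hζ : ContDiff ℝ ∞ ζ) (S : ℝ)
    (w k : Vel d × Vel d) (σ : ℝ) (z : Phase d) :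
    fderiv ℝ (bridge ψ ζ S) ((w, σ), z) ((k, 0), 0) =
      fderiv ℝ ψ (startPt S σ w z) (0,
          (S * (σ ^ 4 - 2 * σ ^ 5)) • k.2 + ((5 * σ ^ 4 - 8 * σ ^ 5) / 3) • k.1,
          (4 * σ - 5 * σ ^ 2) • k.2 + (20 / (3 * S) * (σ - σ ^ 2)) • k.1)
        * ζ (endPt S w (startPt S σ w z))
      + ψ (startPt S σ w z) * fderiv ℝ ζ (endPt S w (startPt S σ w z))
        ((S * (σ ^ 4 - 2 * σ ^ 5)) • k.2 + ((5 * σ ^ 4 - 8 * σ ^ 5) / 3) • k.1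
          - S • ((4 * σ - 5 * σ ^ 2) • k.2 + (20 / (3 * S) * (σ - σ ^ 2)) • k.1) + k.1,
          (4 * σ - 5 * σ ^ 2) • k.2 + (20 / (3 * S) * (σ - σ ^ 2)) • k.1 + k.2) := by
  have p1 := (hasDerivAt_id (0 : ℝ)).smul_const k
  have hw : HasDerivAt (fun s : ℝ => w + s • k) k 0 := by
    simpa using p1.const_add w
  have hc : HasDerivAt (fun s : ℝ => (((w + s • k, σ), z) : ((Vel d × Vel d) × ℝ) × Phase d))
      ((k, 0), 0) 0 := (hw.prodMk (hasDerivAt_const 0 σ)).prodMk (hasDerivAt_const 0 z)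
  refine fderiv_apply_eq_of_hasDerivAt
    ((contDiff_bridge hψ hζ S).differentiable (by simp)) hc (by simp) ?_
  have ha : HasDerivAt (fun s : ℝ => startPt S σ (w + s • k) z) (0,
          (S * (σ ^ 4 - 2 * σ ^ 5)) • k.2 + ((5 * σ ^ 4 - 8 * σ ^ 5) / 3) • k.1,
          (4 * σ - 5 * σ ^ 2) • k.2 + (20 / (3 * S) * (σ - σ ^ 2)) • k.1) 0 :=
    (hasDerivAt_const _ _).prodMk ((hasDerivAt_control_line w k _ _ _).prodMk
      (hasDerivAt_control_line w k _ _ _))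
  have hb : HasDerivAt (fun s : ℝ => endPt S (w + s • k) (startPt S σ (w + s • k) z))
        ((S * (σ ^ 4 - 2 * σ ^ 5)) • k.2 + ((5 * σ ^ 4 - 8 * σ ^ 5) / 3) • k.1
          - S • ((4 * σ - 5 * σ ^ 2) • k.2 + (20 / (3 * S) * (σ - σ ^ 2)) • k.1) + k.1,
          (4 * σ - 5 * σ ^ 2) • k.2 + (20 / (3 * S) * (σ - σ ^ 2)) • k.1 + k.2) 0 :=
    ((ha.snd_comp.fst_comp.sub (ha.snd_comp.snd_comp.const_smul S)).add hw.fst_comp).prodMk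
      (ha.snd_comp.snd_comp.add hw.snd_comp)
  exact hasDerivAt_mul_comp (hψ.differentiable (by simp)) (hζ.differentiable (by simp)) ha hb
    (by rw [zero_smul, add_zero]) (by rw [zero_smul, add_zero])

/-- Along critical trajectories the `σ`-derivative is transport plus a velocity derivative. -/
theorem fderiv_bridge_sigma_eq (hψ : ContDiff ℝ ∞ ψ) (hζ : ContDiff ℝ ∞ ζ) {S : ℝ} (hS : S ≠ 0)
    (w : Vel d × Vel d) (σ : ℝ) (z : Phase d) :
    fderiv ℝ (bridge ψ ζ S) ((w, σ), z) ((0, 1), 0) =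
      3 * S * σ ^ 2 * fderiv ℝ (bridge ψ ζ S) ((w, σ), z) (0, (1, z.2.2, 0))
      + fderiv ℝ (bridge ψ ζ S) ((w, σ), z) (0, (0, 0, steer S (w, σ))) := by
  rw [← smul_eq_mul (3 * S * σ ^ 2), ← map_smul, ← map_add, fderiv_bridge_sigma hψ hζ S w σ z hS]
  simp only [Prod.smul_mk, Prod.mk_add_mk, smul_zero, add_zero, zero_add, fderiv_bridge_phase hψ hζ]
  simp

/-- The velocity derivative is a derivative in the control, up to a term where only `ζ` is
differentiated. -/
theorem fderiv_bridge_control_eq (hψ : ContDiff ℝ ∞ ψ) (hζ : ContDiff ℝ ∞ ζ) {S : ℝ} (hS : S ≠ 0)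
    (w : Vel d × Vel d) (σ : ℝ) (z : Phase d) (e : Vel d) :
    fderiv ℝ (bridge ψ ζ S) ((w, σ), z)
        ((((3 * S * (1 - σ)) • e, (4 * σ - 5) • e), 0), 0) =
      σ ^ 2 * fderiv ℝ (bridge ψ ζ S) ((w, σ), z) (0, (0, 0, e))
      + ψ (startPt S σ w z) * fderiv ℝ ζ (endPt S w (startPt S σ w z))
        ((3 * S * (1 - σ)) • e, (4 * σ - 5) • e) := by
  rw [← smul_eq_mul (σ ^ 2), ← map_smul]
  simp only [Prod.smul_mk, smul_zero, fderiv_bridge_phase hψ hζ, fderiv_bridge_control hψ hζ]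
  -- The control increment solves the 2×2 system that moves the start as the velocity displacement
  -- `σ² e` of `z` does: by `S σ⁵ e` in position and `σ² e` in velocity. The determinant of the
  -- system is `-σ⁶`, and for this right-hand side the solution is polynomial, hence bounded down to
  -- `σ = 0`.
  have e1 : (S * (σ ^ 4 - 2 * σ ^ 5)) • (4 * σ - 5) • e +
      ((5 * σ ^ 4 - 8 * σ ^ 5) / 3) • (3 * S * (1 - σ)) • e = (S * σ ^ 3) • σ ^ 2 • e := by
    simp only [smul_smul, ← add_smul]; congr 1; ring
  have e2 : (4 * σ - 5 * σ ^ 2) • (4 * σ - 5) • e +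
      (20 / (3 * S) * (σ - σ ^ 2)) • (3 * S * (1 - σ)) • e = σ ^ 2 • e := by
    simp only [smul_smul, ← add_smul]; congr 1; field_simp; ring
  rw [e1, e2, add_assoc, ← mul_add, ← map_add]
  simp [sub_smul]

end Derivatives

/-! ### Weak formulations in terms of directional derivatives, and bounds for the coefficients. -/

theorem inner_gradV {φ : Phase d → ℝ} (hφ : Differentiable ℝ φ) (z : Phase d) (e : Vel d) :
    inner ℝ e (gradV φ z) = fderiv ℝ φ z (0, 0, e) := by
  have h1 : HasFDerivAt (fun w : Vel d => ((z.1, z.2.1, w) : Phase d))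
      ((ContinuousLinearMap.inr ℝ ℝ (Vel d × Vel d)).comp
        (ContinuousLinearMap.inr ℝ (Vel d) (Vel d))) z.2.2 :=
    (hasFDerivAt_prodMk_right z.1 (z.2.1, z.2.2)).comp z.2.2
      (hasFDerivAt_prodMk_right z.2.1 z.2.2)
  have h2 := (hφ (z.1, z.2.1, z.2.2)).hasFDerivAt.comp z.2.2 h1
  have h3 : fderiv ℝ (fun w => φ (z.1, z.2.1, w)) z.2.2 = _ := h2.fderiv
  rw [gradV, gradient, real_inner_comm, InnerProductSpace.toDual_symm_apply, h3]
  rfl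

theorem continuous_gradV {φ : Phase d → ℝ} (hφ : ContDiff ℝ ∞ φ) : Continuous (gradV φ) := by
  have h : gradV φ = fun z => (InnerProductSpace.toDual ℝ (Vel d)).symm ((fderiv ℝ φ z).comp
      ((ContinuousLinearMap.inr ℝ ℝ (Vel d × Vel d)).comp
        (ContinuousLinearMap.inr ℝ (Vel d) (Vel d)))) := by
    ext1 z
    refine ext_inner_left ℝ fun e => ?_
    rw [inner_gradV (hφ.differentiable (by simp)), real_inner_comm,
      InnerProductSpace.toDual_symm_apply]
    rfl
  rw [h]
  exact (LinearIsometryEquiv.continuous _).comp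
    ((hφ.continuous_fderiv (by simp)).clm_comp continuous_const)

theorem exists_norm_le_of_isBounded {X F : Type*} [PseudoMetricSpace X] [ProperSpace X]
    [SeminormedAddCommGroup F] {K : X → F} (hK : Continuous K) {U : Set X}
    (hU : Bornology.IsBounded U) : ∃ C, ∀ x ∈ U, ‖K x‖ ≤ C := by
  obtain ⟨C, hC⟩ := hU.isCompact_closure.exists_bound_of_continuousOn hK.continuousOn
  exact ⟨C, fun x hx => hC x (subset_closure hx)⟩

/-- Justifies Fubini between the trajectory parameters and the phase variable: `h` will be `f`, `∇_v
f` or `A ∇_v f`, and `K` is the smooth factor, which is bounded on bounded sets. -/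
theorem integrable_clm_apply {P Z F : Type*} [PseudoMetricSpace P] [ProperSpace P]
    [SecondCountableTopology P] [MeasurableSpace P] [OpensMeasurableSpace P]
    [PseudoMetricSpace Z] [ProperSpace Z] [SecondCountableTopology Z] [MeasurableSpace Z]
    [OpensMeasurableSpace Z] [NormedAddCommGroup F] [NormedSpace ℝ F] [FiniteDimensional ℝ F]
    {ν : Measure P} [IsFiniteMeasureOnCompacts ν] [SFinite ν] {μ : Measure Z} [SFinite μ]
    {B : Set P} (hB : Bornology.IsBounded B) (hBm : MeasurableSet B)
    {U : Set Z} (hU : Bornology.IsBounded U) (hUm : MeasurableSet U)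
    {K : P × Z → F →L[ℝ] ℝ} (hK : Continuous K) {h : Z → F} (hh : IntegrableOn h U μ) :
    Integrable (fun q : P × Z => K q (h q.2)) ((ν.restrict B).prod (μ.restrict U)) := by
  have : IsFiniteMeasure (ν.restrict B) :=
    ⟨by rw [Measure.restrict_apply_univ]; exact hB.measure_lt_top⟩
  obtain ⟨C, hC⟩ := exists_norm_le_of_isBounded hK (hB.prod hU)
  have h1 : Integrable (fun q : P × Z => h q.2) ((ν.restrict B).prod (μ.restrict U)) :=
    Integrable.comp_snd hh _
  refine (h1.norm.const_mul C).mono' ?_ ?_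
  · exact ContinuousLinearMap.aestronglyMeasurable_comp₂ (ContinuousLinearMap.id ℝ (F →L[ℝ] ℝ))
      hK.aestronglyMeasurable h1.aestronglyMeasurable
  · rw [Measure.prod_restrict]
    filter_upwards [ae_restrict_mem (hBm.prod hUm)] with q hq
    exact ((K q).le_opNorm _).trans (mul_le_mul_of_nonneg_right (hC q hq) (norm_nonneg _))

theorem integrableOn_mul_continuous {X : Type*} [PseudoMetricSpace X] [ProperSpace X]
    [MeasurableSpace X] [OpensMeasurableSpace X] {μ : Measure X} {U : Set X}
    (hU : Bornology.IsBounded U) (hUm : MeasurableSet U) {f φ : X → ℝ} (hf : IntegrableOn f U μ)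
    (hφ : Continuous φ) : IntegrableOn (fun x => f x * φ x) U μ := by
  obtain ⟨C, hC⟩ := exists_norm_le_of_isBounded hφ hU
  refine Integrable.mul_bdd (c := C) hf hφ.measurable.aestronglyMeasurable ?_
  filter_upwards [ae_restrict_mem hUm] with x hx using hC x hx

/-- The weak velocity gradient in a fixed direction. -/
theorem HasWeakGradV.integral_mul_fderiv {U : Set (Phase d)} (hU : Bornology.IsBounded U)
    (hUm : MeasurableSet U) {f : Phase d → ℝ} {g : Phase d → Vel d} (h : HasWeakGradV U f g)
    {φ : Phase d → ℝ} (hφ : IsTestFun U φ) (e : Vel d) :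
    ∫ z in U, f z * fderiv ℝ φ z (0, 0, e) = -∫ z in U, φ z * inner ℝ e (g z) := by
  obtain ⟨C, hC⟩ := exists_norm_le_of_isBounded (continuous_gradV hφ.contDiff) hU
  obtain ⟨C', hC'⟩ := exists_norm_le_of_isBounded hφ.contDiff.continuous hU
  have i1 : IntegrableOn (fun z => f z • gradV φ z) U :=
    Integrable.smul_bdd h.integrable_fun C
      (continuous_gradV hφ.contDiff).measurable.aestronglyMeasurable
      (by filter_upwards [ae_restrict_mem hUm] with x hx using hC x hx)
  have i2 : IntegrableOn (fun z => φ z • g z) U :=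
    Integrable.bdd_smul h.integrable_grad C'
      hφ.contDiff.continuous.measurable.aestronglyMeasurable
      (by filter_upwards [ae_restrict_mem hUm] with x hx using hC' x hx)
  have := congrArg (fun x => inner ℝ e x) (h.integral_eq φ hφ)
  simp only [inner_neg_right] at this
  rw [← integral_inner i1, ← integral_inner i2] at this
  simpa only [inner_smul_right, inner_gradV (hφ.contDiff.differentiable (by simp))] using this

/-- For a symmetric operator the quadratic form controls the operator norm, by polarization and the
parallelogram law. It supplies `|A ∇_v f| ≤ Λ |∇_v f|` without any sign of `A`. -/
theorem norm_le_of_abs_inner_self_le {X : Type*} [NormedAddCommGroup X] [InnerProductSpace ℝ X]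
    {T : X →ₗ[ℝ] X} (hT : T.IsSymmetric) {Λ : ℝ} (h : ∀ ξ, |inner ℝ (T ξ) ξ| ≤ Λ * ‖ξ‖ ^ 2)
    (ξ : X) : ‖T ξ‖ ≤ Λ * ‖ξ‖ := by
  by_cases hξ : ξ = 0
  · simp [hξ]
  by_cases hTξ : T ξ = 0
  · rw [hTξ, norm_zero]
    have h1 := (abs_nonneg _).trans (h ξ)
    have h2 : 0 < ‖ξ‖ ^ 2 := by positivity
    have h3 : 0 ≤ Λ := by
      by_contra hc
      nlinarith
    positivity
  have hξ' : 0 < ‖ξ‖ := norm_pos_iff.2 hξ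
  have hTξ' : 0 < ‖T ξ‖ := norm_pos_iff.2 hTξ
  -- Rescaling `ξ` and `T ξ` to equal norms makes polarization lossless: the bounds for `a + b` and
  -- `a - b` then add up to the sharp constant.
  set a := ‖T ξ‖ • ξ with ha
  set b := ‖ξ‖ • T ξ with hb
  have na : ‖a‖ = ‖T ξ‖ * ‖ξ‖ := by simp [ha, norm_smul]
  have nb : ‖b‖ = ‖T ξ‖ * ‖ξ‖ := by simp [hb, norm_smul, mul_comm]
  have hab : inner ℝ (T a) b = ‖T ξ‖ ^ 3 * ‖ξ‖ := by
    simp [ha, hb, inner_smul_left, inner_smul_right]; ring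
  have hba : inner ℝ (T b) a = inner ℝ (T a) b := by
    rw [hT b a, real_inner_comm]
  have e1 : 4 * inner ℝ (T a) b = inner ℝ (T (a + b)) (a + b) - inner ℝ (T (a - b)) (a - b) := by
    simp only [map_add, map_sub, inner_add_left, inner_add_right, inner_sub_left, inner_sub_right,
      hba]
    ring
  have e2 := parallelogram_law_with_norm ℝ a b
  have h1 := (abs_le.1 (h (a + b))).2
  have h2 := (abs_le.1 (h (a - b))).1
  have e3 : 4 * (‖T ξ‖ ^ 3 * ‖ξ‖) ≤ 4 * (Λ * (‖T ξ‖ * ‖ξ‖) ^ 2) := by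
    rw [← hab, e1]
    have : Λ * ‖a + b‖ ^ 2 + Λ * ‖a - b‖ ^ 2 = 4 * (Λ * (‖T ξ‖ * ‖ξ‖) ^ 2) := by
      rw [na, nb] at e2
      linear_combination Λ * e2
    linarith
  have e4 : (‖T ξ‖ ^ 2 * ‖ξ‖) * ‖T ξ‖ ≤ (‖T ξ‖ ^ 2 * ‖ξ‖) * (Λ * ‖ξ‖) := by nlinarith
  exact le_of_mul_le_mul_left e4 (by positivity)

theorem IsBoundedCoeff.norm_le {U : Set (Phase d)} {Λ : ℝ} {A : Phase d → Matrix (Fin d) (Fin d) ℝ}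
    (hA : IsBoundedCoeff U Λ A) (g : Phase d → Vel d) :
    ∀ᵐ z ∂(volume.restrict U), ‖(A z).toEuclideanLin (g z)‖ ≤ Λ * ‖g z‖ := by
  filter_upwards [hA.isSymm, hA.bound] with z h1 h2
  refine norm_le_of_abs_inner_self_le ?_ h2 (g z)
  rw [Matrix.isSymmetric_toEuclideanLin_iff]
  rw [Matrix.IsHermitian, Matrix.conjTranspose_eq_transpose_of_trivial]
  exact h1

theorem IsBoundedCoeff.integrableOn {U : Set (Phase d)} {Λ : ℝ}
    {A : Phase d → Matrix (Fin d) (Fin d) ℝ} (hA : IsBoundedCoeff U Λ A) {g : Phase d → Vel d}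
    (hg : IntegrableOn g U) : IntegrableOn (fun z => (A z).toEuclideanLin (g z)) U := by
  refine (hg.norm.const_mul Λ).mono' ?_ (hA.norm_le g)
  have h1 : AEMeasurable (fun z => fun i => ∑ j, A z i j * g z j) (volume.restrict U) := by
    refine aemeasurable_pi_lambda _ fun i => ?_
    refine Finset.aemeasurable_fun_sum _ fun j _ => ?_
    refine (hA.aemeasurable i j).mul ?_
    exact (EuclideanSpace.proj (𝕜 := ℝ) j).continuous.measurable.comp_aemeasurable
      hg.aestronglyMeasurable.aemeasurable
  have h2 := ((PiLp.continuous_toLp 2 (fun _ : Fin d => ℝ)).measurable.comp_aemeasurable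
    h1).aestronglyMeasurable
  refine h2.congr (Filter.Eventually.of_forall fun z => ?_)
  ext i
  simp [Matrix.toEuclideanLin, Matrix.mulVec, dotProduct]

/-- The subsolution inequality in terms of the derivative of the test function. -/
theorem IsWeakSubsolution.integral_fderiv_le {U : Set (Phase d)}
    {A : Phase d → Matrix (Fin d) (Fin d) ℝ} {f : Phase d → ℝ} {g : Phase d → Vel d}
    (h : IsWeakSubsolution U A f g) {φ : Phase d → ℝ} (hφ : IsTestFun U φ) (h0 : ∀ z, 0 ≤ φ z) :
    -∫ z in U, f z * fderiv ℝ φ z (1, z.2.2, 0) ≤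
      -∫ z in U, fderiv ℝ φ z (0, 0, (A z).toEuclideanLin (g z)) := by
  have := h.integral_le φ hφ h0
  simpa only [transport, inner_gradV (hφ.contDiff.differentiable (by simp))] using this

theorem integral_fderiv_eq_zero {X : Type*} [NormedAddCommGroup X] [NormedSpace ℝ X]
    [FiniteDimensional ℝ X] [MeasurableSpace X] [BorelSpace X] {μ : Measure X}
    [μ.IsAddHaarMeasure] {F : X → ℝ} (hF : ContDiff ℝ ∞ F) (hc : HasCompactSupport F) (k : X) :
    ∫ x, fderiv ℝ F x k ∂μ = 0 := by
  have i1 : Integrable (fun x => fderiv ℝ F x k) μ :=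
    ((hF.continuous_fderiv (by simp)).clm_apply continuous_const).integrable_of_hasCompactSupport
      (hc.fderiv_apply ℝ k)
  have := integral_mul_fderiv_eq_neg_fderiv_mul_of_integrable (μ := μ) (f := fun _ : X => (1 : ℝ))
    (g := F) (v := k) (by simp) (by simpa using i1)
    (by simpa using hF.continuous.integrable_of_hasCompactSupport hc)
    (fun _ _ => differentiableAt_const _) (fun x _ => hF.differentiable (by simp) x)
  simpa using this

instance isAddHaarMeasure_volume_prod :
    (volume : Measure (Vel d × Vel d)).IsAddHaarMeasure :=
  inferInstanceAs ((volume : Measure (Vel d)).prod (volume : Measure (Vel d))).IsAddHaarMeasure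

/-! ### The bridge averaged over controls: endpoint values and removal of derivatives of `ψ`. -/

/-- The mass of `ψ` at a given time. -/
def timeMarginal (ψ : Phase d → ℝ) (t : ℝ) : ℝ := ∫ p : Vel d × Vel d, ψ (t, p)

section Bridge

variable {ψ : Phase d → ℝ} {ζ : Vel d × Vel d → ℝ} {S : ℝ}

theorem bridge_eq_zero {σ : ℝ} {w : Vel d × Vel d} {z : Phase d}
    (h : ¬ (startPt S σ w z ∈ tsupport ψ ∧ endPt S w (startPt S σ w z) ∈ tsupport ζ)) :
    bridge ψ ζ S ((w, σ), z) = 0 := by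
  rw [not_and_or] at h
  rcases h with h | h
  · simp [bridge, image_eq_zero_of_notMem_tsupport h]
  · simp [bridge, image_eq_zero_of_notMem_tsupport h]

theorem tsupport_bridge_subset : tsupport (bridge ψ ζ S) ⊆
    {q | startPt S q.1.2 q.1.1 q.2 ∈ tsupport ψ ∧
      endPt S q.1.1 (startPt S q.1.2 q.1.1 q.2) ∈ tsupport ζ} := by
  refine closure_minimal (fun q hq => ?_) ?_
  · by_contra hc
    exact hq (bridge_eq_zero hc)
  · exact ((isClosed_tsupport ψ).preimage (contDiff_startPt S).continuous).inter
      ((isClosed_tsupport ζ).preimage (contDiff_endPt S).continuous)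

theorem isTestFun_bridge (hψ : ContDiff ℝ ∞ ψ) (hζ : ContDiff ℝ ∞ ζ) {U : Set (Phase d)}
    (hU : Bornology.IsBounded U) {p : (Vel d × Vel d) × ℝ}
    (hp : ∀ z, startPt S p.2 p.1 z ∈ tsupport ψ →
      endPt S p.1 (startPt S p.2 p.1 z) ∈ tsupport ζ → z ∈ U) :
    IsTestFun U (fun z => bridge ψ ζ S (p, z)) := by
  have hs : tsupport (fun z => bridge ψ ζ S (p, z)) ⊆ U := fun z hz => by
    have := tsupport_bridge_subset (tsupport_comp_subset_preimage (bridge ψ ζ S)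
      (f := fun z => (p, z)) (by fun_prop) hz)
    exact hp z this.1 this.2
  exact ⟨(contDiff_bridge hψ hζ S).comp (contDiff_prodMk_right p),
    Metric.isCompact_of_isClosed_isBounded (isClosed_tsupport _) (hU.subset hs), hs⟩

theorem bridge_zero (w : Vel d × Vel d) (z : Phase d) :
    bridge ψ ζ S ((w, 0), z) = ψ z * ζ ((z.2.1 - S • z.2.2, z.2.2) + w) := by
  simp [bridge, startPt, endPt, Prod.add_def]

theorem bridge_one (w : Vel d × Vel d) (z : Phase d) :
    bridge ψ ζ S ((w, 1), z) =
      ψ (z.1 + S, z.2.1 + S • z.2.2 - S • w.2 - w.1, z.2.2 - w.2) * ζ z.2 := by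
  have h : startPt S 1 w z = (z.1 + S, z.2.1 + S • z.2.2 - S • w.2 - w.1, z.2.2 - w.2) := by
    simp only [startPt]
    norm_num
    constructor
    · module
    · module
  simp only [bridge, h, endPt]
  congr 2
  ext1
  · simp only; module
  · simp

/-- At `σ = 1` the trajectory ends at `z`, so `ζ` factors out, while the start sweeps the whole
slice at time `z.1 + S` as `w` varies. The sweep is a shear composed with a reflection and a
translation, hence preserves volume. -/
theorem integral_bridge_one (hψ : Continuous ψ) (hψc : HasCompactSupport ψ)
    (z : Phase d) :
    ∫ w, bridge ψ ζ S ((w, 1), z) = timeMarginal ψ (z.1 + S) * ζ z.2 := by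
  simp only [bridge_one, integral_mul_const]
  congr 1
  have hsec : ∀ t : ℝ, HasCompactSupport fun p : Vel d × Vel d => ψ (t, p) := fun t =>
    HasCompactSupport.intro (hψc.isCompact.image continuous_snd) fun p hp =>
      image_eq_zero_of_notMem_tsupport fun h => hp ⟨_, h, rfl⟩
  have i1 : Integrable fun p : Vel d × Vel d => ψ (z.1 + S, p) :=
    (by fun_prop : Continuous fun p : Vel d × Vel d => ψ (z.1 + S, p)).integrable_of_hasCompactSupport
      (hsec _)
  let T : (Vel d × Vel d) ≃ₜ (Vel d × Vel d) :=
    { toFun := fun w => (z.2.1 + S • z.2.2 - S • w.2 - w.1, z.2.2 - w.2)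
      invFun := fun p => (z.2.1 + S • z.2.2 - S • (z.2.2 - p.2) - p.1, z.2.2 - p.2)
      left_inv := fun w => by ext1 <;> simp
      right_inv := fun w => by ext1 <;> simp
      continuous_toFun := by fun_prop
      continuous_invFun := by fun_prop }
  have i2 : Integrable fun w : Vel d × Vel d =>
      ψ (z.1 + S, z.2.1 + S • z.2.2 - S • w.2 - w.1, z.2.2 - w.2) :=
    (by fun_prop : Continuous fun w : Vel d × Vel d =>
      ψ (z.1 + S, z.2.1 + S • z.2.2 - S • w.2 - w.1, z.2.2 - w.2)).integrable_of_hasCompactSupport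
      ((hsec (z.1 + S)).comp_homeomorph T)
  rw [timeMarginal, Measure.volume_eq_prod, integral_prod_symm _ i2, integral_prod_symm _ i1]
  -- With the velocity integral outermost, the shear becomes a reflected translation in each
  -- variable separately.
  rw [← integral_sub_left_eq_self (fun u => ∫ y, ψ (z.1 + S, y, u)) volume z.2.2]
  refine integral_congr_ae (Filter.Eventually.of_forall fun u => ?_)
  exact integral_sub_left_eq_self (fun y => ψ (z.1 + S, y, z.2.2 - u)) volume
    (z.2.1 + S • z.2.2 - S • u)

theorem integral_bridge_zero (z : Phase d) :
    ∫ w, bridge ψ ζ S ((w, 0), z) = ψ z * ∫ p, ζ p := by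
  simp only [bridge_zero, integral_const_mul]
  congr 1
  exact integral_add_left_eq_self ζ _

/-- The fundamental theorem of calculus in `σ` leaves the two endpoint values. The support condition
`hw` lets the unit ball of controls be replaced by the whole space, where translation invariance
evaluates the averages. -/
theorem setIntegral_fderiv_bridge_sigma (hψ : ContDiff ℝ ∞ ψ) (hζ : ContDiff ℝ ∞ ζ)
    (hψc : HasCompactSupport ψ)
    {z : Phase d} (hw : ∀ σ ∈ Icc (0 : ℝ) 1, ∀ w, startPt S σ w z ∈ tsupport ψ →
      endPt S w (startPt S σ w z) ∈ tsupport ζ → w ∈ Metric.ball 0 1) :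
    ∫ p in Metric.ball (0 : Vel d × Vel d) 1 ×ˢ Ioc (0 : ℝ) 1,
      fderiv ℝ (bridge ψ ζ S) (p, z) ((0, 1), 0) =
    timeMarginal ψ (z.1 + S) * ζ z.2 - ψ z * ∫ p, ζ p := by
  have hD := (contDiff_bridge hψ hζ S).continuous_fderiv (by simp)
  have hH := (contDiff_bridge hψ hζ S).continuous
  have i1 : IntegrableOn (fun p : (Vel d × Vel d) × ℝ =>
      fderiv ℝ (bridge ψ ζ S) (p, z) ((0, 1), 0))
      (Metric.ball (0 : Vel d × Vel d) 1 ×ˢ Ioc (0 : ℝ) 1) (volume.prod volume) := by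
    have hb : Bornology.IsBounded (Metric.ball (0 : Vel d × Vel d) 1 ×ˢ Ioc (0 : ℝ) 1) :=
      Metric.isBounded_ball.prod (Metric.isBounded_Ioc 0 1)
    exact ((by fun_prop : Continuous fun p : (Vel d × Vel d) × ℝ =>
      fderiv ℝ (bridge ψ ζ S) (p, z) ((0, 1), 0)).continuousOn.integrableOn_compact
      hb.isCompact_closure).mono_set subset_closure
  rw [Measure.volume_eq_prod, setIntegral_prod _ i1]
  have h1 : ∀ w : Vel d × Vel d, ∫ σ in Ioc (0 : ℝ) 1,
      fderiv ℝ (bridge ψ ζ S) ((w, σ), z) ((0, 1), 0) =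
      bridge ψ ζ S ((w, 1), z) - bridge ψ ζ S ((w, 0), z) := fun w => by
    rw [← intervalIntegral.integral_of_le zero_le_one]
    refine intervalIntegral.integral_eq_sub_of_hasDerivAt
      (f := fun σ => bridge ψ ζ S ((w, σ), z)) (fun σ _ => ?_) ?_
    · exact ((contDiff_bridge hψ hζ S).differentiable (by simp) _).hasFDerivAt.comp_hasDerivAt σ
        (((hasDerivAt_const σ w).prodMk (hasDerivAt_id σ)).prodMk (hasDerivAt_const σ z))
    · exact Continuous.intervalIntegrable (by fun_prop) _ _
  simp only [h1]
  have hzero : ∀ σ ∈ Icc (0 : ℝ) 1, ∀ w ∉ Metric.ball (0 : Vel d × Vel d) 1,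
      bridge ψ ζ S ((w, σ), z) = 0 := fun σ hσ w hwb =>
    bridge_eq_zero fun h => hwb (hw σ hσ w h.1 h.2)
  have i2 : ∀ σ ∈ Icc (0 : ℝ) 1, IntegrableOn (fun w => bridge ψ ζ S ((w, σ), z))
      (Metric.ball (0 : Vel d × Vel d) 1) := fun σ _ =>
    ((by fun_prop : Continuous fun w => bridge ψ ζ S ((w, σ), z)).continuousOn.integrableOn_compact
      (isCompact_closedBall 0 1)).mono_set Metric.ball_subset_closedBall
  rw [integral_sub (i2 1 (by simp)) (i2 0 (by simp)),
    setIntegral_eq_integral_of_forall_compl_eq_zero (hzero 1 (by simp)),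
    setIntegral_eq_integral_of_forall_compl_eq_zero (hzero 0 (by simp)),
    integral_bridge_one hψ.continuous hψc, integral_bridge_zero]

theorem fderiv_bridge_fst (hψ : ContDiff ℝ ∞ ψ) (hζ : ContDiff ℝ ∞ ζ) (w k : Vel d × Vel d)
    (σ : ℝ) (z : Phase d) :
    fderiv ℝ (fun w => bridge ψ ζ S ((w, σ), z)) w k =
      fderiv ℝ (bridge ψ ζ S) ((w, σ), z) ((k, 0), 0) := by
  have h1 : HasFDerivAt (fun w : Vel d × Vel d => ((w, σ), z))
      ((ContinuousLinearMap.inl ℝ ((Vel d × Vel d) × ℝ) (Phase d)).comp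
        (ContinuousLinearMap.inl ℝ (Vel d × Vel d) ℝ)) w :=
    HasFDerivAt.comp (g := fun p : (Vel d × Vel d) × ℝ => (p, z)) w
      (hasFDerivAt_prodMk_left (w, σ) z) (hasFDerivAt_prodMk_left w σ)
  have h2 := ((contDiff_bridge hψ hζ S).differentiable (by simp) ((w, σ), z)).hasFDerivAt.comp w h1
  have h3 : fderiv ℝ (fun w => bridge ψ ζ S ((w, σ), z)) w = _ := h2.fderiv
  rw [h3]
  rfl

/-- As a function of the control the bridge is compactly supported inside the ball, so no boundary
term appears. -/
theorem setIntegral_fderiv_bridge_fst (hψ : ContDiff ℝ ∞ ψ) (hζ : ContDiff ℝ ∞ ζ) {σ : ℝ}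
    {z : Phase d}
    (hw : ∀ w, startPt S σ w z ∈ tsupport ψ →
      endPt S w (startPt S σ w z) ∈ tsupport ζ → w ∈ Metric.ball 0 1) (k : Vel d × Vel d) :
    ∫ w in Metric.ball (0 : Vel d × Vel d) 1,
      fderiv ℝ (bridge ψ ζ S) ((w, σ), z) ((k, 0), 0) = 0 := by
  simp only [← fderiv_bridge_fst hψ hζ]
  have hFs : ContDiff ℝ ∞ fun w => bridge ψ ζ S ((w, σ), z) :=
    (contDiff_bridge hψ hζ S).comp (by fun_prop)
  have hFt : tsupport (fun w => bridge ψ ζ S ((w, σ), z)) ⊆ Metric.ball 0 1 := fun w hwt => by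
    have := tsupport_bridge_subset (tsupport_comp_subset_preimage (bridge ψ ζ S)
      (f := fun w => ((w, σ), z)) (by fun_prop) hwt)
    exact hw w this.1 this.2
  have hFc : HasCompactSupport fun w => bridge ψ ζ S ((w, σ), z) :=
    Metric.isCompact_of_isClosed_isBounded (isClosed_tsupport _)
      (Metric.isBounded_ball.subset hFt)
  rw [setIntegral_eq_integral_of_forall_compl_eq_zero, integral_fderiv_eq_zero hFs hFc]
  intro w hwb
  have : fderiv ℝ (fun w => bridge ψ ζ S ((w, σ), z)) w = 0 := by
    by_contra hne
    exact hwb (hFt (support_fderiv_subset ℝ hne))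
  simp [this]

theorem continuous_startPt_control (S σ : ℝ) (z : Phase d) :
    Continuous fun w : Vel d × Vel d => startPt S σ w z := by
  unfold startPt; fun_prop

theorem continuous_endPt_control (S σ : ℝ) (z : Phase d) :
    Continuous fun w : Vel d × Vel d => endPt S w (startPt S σ w z) := by
  unfold endPt startPt; fun_prop

/-- The velocity derivative, weighted by `σ²`, is a control derivative, which averages to zero,
minus a term in which only `ζ` is differentiated. Hence the bound sees `ψ` only through `0 ≤ ψ ≤ 1`.
-/
theorem norm_setIntegral_fderiv_bridge_velocity_le (hψ : ContDiff ℝ ∞ ψ) (hζ : ContDiff ℝ ∞ ζ)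
    (hS : S ≠ 0) {σ : ℝ} (hσ : σ ∈ Ioc (0 : ℝ) 1) {z : Phase d}
    (hw : ∀ w, startPt S σ w z ∈ tsupport ψ →
      endPt S w (startPt S σ w z) ∈ tsupport ζ → w ∈ Metric.ball 0 1) {c : ℝ}
    (hψ0 : ∀ z, 0 ≤ ψ z) (hψ1 : ∀ z, ψ z ≤ 1) (hc : ∀ p, ‖fderiv ℝ ζ p‖ ≤ c) (e : Vel d) :
    ‖∫ w in Metric.ball (0 : Vel d × Vel d) 1,
      σ ^ 2 * fderiv ℝ (bridge ψ ζ S) ((w, σ), z) (0, (0, 0, e))‖ ≤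
      (c * ((3 * |S| + 5) * ‖e‖)) * volume.real (Metric.ball (0 : Vel d × Vel d) 1) := by
  have hc0 : 0 ≤ c := (norm_nonneg _).trans (hc 0)
  obtain ⟨k, hk⟩ : ∃ k : Vel d × Vel d, k = ((3 * S * (1 - σ)) • e, (4 * σ - 5) • e) := ⟨_, rfl⟩
  have hkn : ‖k‖ ≤ (3 * |S| + 5) * ‖e‖ := by
    rw [hk]
    refine norm_prod_le_iff.2 ⟨?_, ?_⟩
    · rw [norm_smul, Real.norm_eq_abs, abs_mul, abs_mul, abs_of_pos (three_pos (α := ℝ)),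
        abs_of_nonneg (by linarith [hσ.2] : 0 ≤ 1 - σ)]
      gcongr
      nlinarith [abs_nonneg S, hσ.1]
    · rw [norm_smul, Real.norm_eq_abs]
      gcongr
      rw [abs_le]
      constructor <;> nlinarith [abs_nonneg S, hσ.1, hσ.2]
  have e1 : ∀ w, σ ^ 2 * fderiv ℝ (bridge ψ ζ S) ((w, σ), z) (0, (0, 0, e)) =
      fderiv ℝ (bridge ψ ζ S) ((w, σ), z) ((k, 0), 0)
        - ψ (startPt S σ w z) * fderiv ℝ ζ (endPt S w (startPt S σ w z)) k := fun w => by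
    rw [hk, fderiv_bridge_control_eq hψ hζ hS]; ring
  have hcs := continuous_startPt_control S σ z
  have hce := continuous_endPt_control S σ z
  have hcd := hζ.continuous_fderiv (by simp)
  have hD := (contDiff_bridge hψ hζ S).continuous_fderiv (by simp)
  have hψc := hψ.continuous
  have icont : ∀ G : Vel d × Vel d → ℝ, Continuous G →
      IntegrableOn G (Metric.ball (0 : Vel d × Vel d) 1) := fun G hG =>
    (hG.continuousOn.integrableOn_compact (isCompact_closedBall 0 1)).mono_set
      Metric.ball_subset_closedBall
  have i1 := icont (fun w => fderiv ℝ (bridge ψ ζ S) ((w, σ), z) ((k, 0), 0)) (by fun_prop)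
  have i2 := icont (fun w => ψ (startPt S σ w z) * fderiv ℝ ζ (endPt S w (startPt S σ w z)) k)
    ((hψc.comp hcs).mul ((hcd.comp hce).clm_apply continuous_const))
  have e2 : ∫ w in Metric.ball (0 : Vel d × Vel d) 1,
      σ ^ 2 * fderiv ℝ (bridge ψ ζ S) ((w, σ), z) (0, (0, 0, e)) =
      -∫ w in Metric.ball (0 : Vel d × Vel d) 1,
        ψ (startPt S σ w z) * fderiv ℝ ζ (endPt S w (startPt S σ w z)) k := by
    have h0 := setIntegral_fderiv_bridge_fst hψ hζ hw k
    have h1 := integral_sub i1 i2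
    rw [h0, zero_sub] at h1
    rw [← h1]
    exact integral_congr_ae (Filter.Eventually.of_forall e1)
  rw [e2, norm_neg]
  refine norm_setIntegral_le_of_norm_le_const measure_ball_lt_top fun w _ => ?_
  rw [norm_mul, Real.norm_eq_abs, abs_of_nonneg (hψ0 _), ← one_mul (c * _)]
  exact mul_le_mul (hψ1 _) (((fderiv ℝ ζ _).le_opNorm k).trans
    (mul_le_mul (hc _) hkn (norm_nonneg _) hc0)) (norm_nonneg _) zero_le_one

/-- Averaging over the control removes the derivative of `ψ`. -/
theorem abs_setIntegral_fderiv_bridge_velocity_le (hψ : ContDiff ℝ ∞ ψ) (hζ : ContDiff ℝ ∞ ζ)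
    (hS : S ≠ 0) {z : Phase d}
    (hw : ∀ σ ∈ Icc (0 : ℝ) 1, ∀ w, startPt S σ w z ∈ tsupport ψ →
      endPt S w (startPt S σ w z) ∈ tsupport ζ → w ∈ Metric.ball 0 1) {c : ℝ}
    (hψ0 : ∀ z, 0 ≤ ψ z) (hψ1 : ∀ z, ψ z ≤ 1) (hc : ∀ p, ‖fderiv ℝ ζ p‖ ≤ c) (e : Vel d) :
    |∫ p in Metric.ball (0 : Vel d × Vel d) 1 ×ˢ Ioc (0 : ℝ) 1,
      p.2 ^ 2 * fderiv ℝ (bridge ψ ζ S) (p, z) (0, (0, 0, e))| ≤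
      (c * ((3 * |S| + 5) * ‖e‖)) * volume.real (Metric.ball (0 : Vel d × Vel d) 1) := by
  have hD := (contDiff_bridge hψ hζ S).continuous_fderiv (by simp)
  have hb : Bornology.IsBounded (Metric.ball (0 : Vel d × Vel d) 1 ×ˢ Ioc (0 : ℝ) 1) :=
    Metric.isBounded_ball.prod (Metric.isBounded_Ioc 0 1)
  have i1 : IntegrableOn (fun p : (Vel d × Vel d) × ℝ =>
      p.2 ^ 2 * fderiv ℝ (bridge ψ ζ S) (p, z) (0, (0, 0, e)))
      (Metric.ball (0 : Vel d × Vel d) 1 ×ˢ Ioc (0 : ℝ) 1) (volume.prod volume) :=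
    ((by fun_prop : Continuous fun p : (Vel d × Vel d) × ℝ =>
      p.2 ^ 2 * fderiv ℝ (bridge ψ ζ S) (p, z) (0, (0, 0, e))).continuousOn.integrableOn_compact
      hb.isCompact_closure).mono_set subset_closure
  rw [IntegrableOn, ← Measure.prod_restrict] at i1
  rw [Measure.volume_eq_prod, ← Measure.prod_restrict, integral_prod_symm _ i1]
  have := norm_setIntegral_le_of_norm_le_const (μ := volume) (s := Ioc (0 : ℝ) 1) (by simp)
    fun σ hσ => norm_setIntegral_fderiv_bridge_velocity_le hψ hζ hS hσ
      (hw σ ⟨hσ.1.le, hσ.2⟩) hψ0 hψ1 hc e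
  simpa using this

end Bridge

theorem norm_steer_le (S : ℝ) {p : (Vel d × Vel d) × ℝ}
    (hp : p ∈ Metric.ball (0 : Vel d × Vel d) 1 ×ˢ Ioc (0 : ℝ) 1) :
    ‖steer S p‖ ≤ 6 + 20 / (3 * |S|) := by
  obtain ⟨⟨y, u⟩, σ⟩ := p
  obtain ⟨hw, hσ⟩ := hp
  have hw : ‖(y, u)‖ < 1 := mem_ball_zero_iff.1 hw
  simp only [mem_Ioc] at hσ
  have hy : ‖y‖ ≤ 1 := (norm_fst_le (y, u)).trans hw.le
  have hu : ‖u‖ ≤ 1 := (norm_snd_le (y, u)).trans hw.le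
  refine (norm_add_le _ _).trans (add_le_add ?_ ?_)
  · rw [norm_smul, ← mul_one (6 : ℝ)]
    refine mul_le_mul ?_ hu (norm_nonneg _) (by norm_num)
    rw [Real.norm_eq_abs, abs_le]
    constructor <;> simp only <;> linarith [hσ.1, hσ.2]
  · rw [norm_smul, ← mul_one (20 / (3 * |S|) : ℝ)]
    refine mul_le_mul ?_ hy (norm_nonneg _) (by positivity)
    rw [norm_mul, norm_div, norm_mul, Real.norm_eq_abs S, ← mul_one (20 / (3 * |S|))]
    norm_num
    refine mul_le_of_le_one_right (by positivity) ?_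
    rw [abs_le]
    constructor <;> linarith [hσ.1, hσ.2]

/-! ### The subsolution inequality integrated along the trajectories. -/

section Bridge

variable {ψ : Phase d → ℝ} {ζ : Vel d × Vel d → ℝ} {S : ℝ}

theorem fderiv_bridge_snd (hψ : ContDiff ℝ ∞ ψ) (hζ : ContDiff ℝ ∞ ζ)
    (p : (Vel d × Vel d) × ℝ) (z k : Phase d) :
    fderiv ℝ (fun z => bridge ψ ζ S (p, z)) z k = fderiv ℝ (bridge ψ ζ S) (p, z) (0, k) := by
  have h2 := ((contDiff_bridge hψ hζ S).differentiable (by simp) (p, z)).hasFDerivAt.comp z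
    (hasFDerivAt_prodMk_right p z)
  have h3 : fderiv ℝ (fun z => bridge ψ ζ S (p, z)) z = _ := h2.fderiv
  rw [h3]
  rfl

/-- The subsolution inequality tested against one member of the family of bridges. -/
theorem bridge_inequality_pointwise {U : Set (Phase d)} (hU : Bornology.IsBounded U)
    (hUm : MeasurableSet U) {A : Phase d → Matrix (Fin d) (Fin d) ℝ} {f : Phase d → ℝ}
    {g : Phase d → Vel d} (hf : IsWeakSubsolution U A f g) (hψ : ContDiff ℝ ∞ ψ)
    (hζ : ContDiff ℝ ∞ ζ) (hS : S ≠ 0) (hψ0 : ∀ z, 0 ≤ ψ z) (hζ0 : ∀ p, 0 ≤ ζ p)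
    {p : (Vel d × Vel d) × ℝ}
    (hp : ∀ z, startPt S p.2 p.1 z ∈ tsupport ψ →
      endPt S p.1 (startPt S p.2 p.1 z) ∈ tsupport ζ → z ∈ U) :
    -(|S| / S) * ∫ z in U, fderiv ℝ (bridge ψ ζ S) (p, z) ((0, 1), 0) * f z ≤
      |S| / S * (∫ z in U, bridge ψ ζ S (p, z) * inner ℝ (steer S p) (g z)) -
      3 * |S| * ∫ z in U, p.2 ^ 2 *
        fderiv ℝ (bridge ψ ζ S) (p, z) (0, (0, 0, (A z).toEuclideanLin (g z))) := by
  have hφ := isTestFun_bridge hψ hζ hU hp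
  have h1 := hf.integral_fderiv_le hφ fun z => mul_nonneg (hψ0 _) (hζ0 _)
  have h2 := hf.weakGrad.integral_mul_fderiv hU hUm hφ (steer S p)
  simp only [fderiv_bridge_snd hψ hζ] at h1 h2
  have hD := (contDiff_bridge hψ hζ S).continuous_fderiv (by simp)
  have hDp : Continuous fun z => fderiv ℝ (bridge ψ ζ S) (p, z) := by fun_prop
  have i1 := integrableOn_mul_continuous hU hUm hf.weakGrad.integrable_fun
    (hDp.clm_apply (by fun_prop : Continuous fun z : Phase d =>
      ((0, (1, z.2.2, 0)) : ((Vel d × Vel d) × ℝ) × Phase d)))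
  have i2 := integrableOn_mul_continuous hU hUm hf.weakGrad.integrable_fun
    (hDp.clm_apply (by fun_prop : Continuous fun z : Phase d =>
      ((0, (0, 0, steer S p)) : ((Vel d × Vel d) × ℝ) × Phase d)))
  have h3 : ∫ z in U, fderiv ℝ (bridge ψ ζ S) (p, z) ((0, 1), 0) * f z =
      3 * S * p.2 ^ 2 * (∫ z in U, f z * fderiv ℝ (bridge ψ ζ S) (p, z) (0, (1, z.2.2, 0)))
      + ∫ z in U, f z * fderiv ℝ (bridge ψ ζ S) (p, z) (0, (0, 0, steer S p)) := by
    rw [← integral_const_mul, ← integral_add (i1.const_mul _) i2]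
    refine integral_congr_ae (Filter.Eventually.of_forall fun z => ?_)
    simp only
    rw [fderiv_bridge_sigma_eq hψ hζ hS p.1 p.2 z]
    ring
  rw [h3, h2, integral_const_mul]
  -- The transport weight `3Sσ²` has the sign of `S`, whereas an inequality may only be multiplied
  -- by the nonnegative `3|S|σ²`; the factor `|S|/S` reconciles the two.
  have h4 := mul_le_mul_of_nonneg_left h1 (by positivity : 0 ≤ 3 * |S| * p.2 ^ 2)
  have h5 : |S| / S * S = |S| := div_mul_cancel₀ _ hS
  have h6 : ∀ x : ℝ, -(|S| / S) * (3 * S * p.2 ^ 2 * x) = 3 * |S| * p.2 ^ 2 * (-x) := fun x => by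
    linear_combination (-3 * p.2 ^ 2 * x) * h5
  rw [mul_add, h6]
  linarith

theorem abs_setIntegral_bridge_mul_inner_le {U : Set (Phase d)} {g : Phase d → Vel d}
    (hg : IntegrableOn g U) (hψ0 : ∀ z, 0 ≤ ψ z) (hψ1 : ∀ z, ψ z ≤ 1) (hζ0 : ∀ p, 0 ≤ ζ p)
    {c : ℝ} (hc : ∀ p, ζ p ≤ c) {p : (Vel d × Vel d) × ℝ}
    (hp : p ∈ Metric.ball (0 : Vel d × Vel d) 1 ×ˢ Ioc (0 : ℝ) 1) :
    |∫ z in U, bridge ψ ζ S (p, z) * inner ℝ (steer S p) (g z)| ≤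
      c * (6 + 20 / (3 * |S|)) * ∫ z in U, ‖g z‖ := by
  rw [← integral_const_mul, ← Real.norm_eq_abs]
  refine norm_integral_le_of_norm_le (hg.norm.const_mul _)
    (Filter.Eventually.of_forall fun z => ?_)
  have h1 : ‖bridge ψ ζ S (p, z)‖ ≤ c := by
    rw [bridge, Real.norm_eq_abs, abs_of_nonneg (mul_nonneg (hψ0 _) (hζ0 _)), ← one_mul c]
    exact mul_le_mul (hψ1 _) (hc _) (hζ0 _) zero_le_one
  rw [norm_mul, mul_assoc]
  refine mul_le_mul h1 ((norm_inner_le_norm _ _).trans ?_) (norm_nonneg _) ((norm_nonneg _).trans h1)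
  exact mul_le_mul_of_nonneg_right (norm_steer_le S hp) (norm_nonneg _)

/-- Integrating a subsolution along critical trajectories from `ψ` to a multiple of `ζ`. -/
theorem bridge_inequality {U : Set (Phase d)} (hU : Bornology.IsBounded U)
    (hUm : MeasurableSet U) {Λ : ℝ} {A : Phase d → Matrix (Fin d) (Fin d) ℝ}
    (hA : IsBoundedCoeff U Λ A) {f : Phase d → ℝ} {g : Phase d → Vel d}
    (hf : IsWeakSubsolution U A f g) (hψ : ContDiff ℝ ∞ ψ) (hψc : HasCompactSupport ψ)
    (hζ : ContDiff ℝ ∞ ζ) (hS : S ≠ 0) (hψ0 : ∀ z, 0 ≤ ψ z) (hψ1 : ∀ z, ψ z ≤ 1)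
    (hζ0 : ∀ p, 0 ≤ ζ p) {c₀ c₁ : ℝ} (hc₀ : ∀ p, ζ p ≤ c₀) (hc₁ : ∀ p, ‖fderiv ℝ ζ p‖ ≤ c₁)
    (hp : ∀ σ ∈ Icc (0 : ℝ) 1, ∀ w z, startPt S σ w z ∈ tsupport ψ →
      endPt S w (startPt S σ w z) ∈ tsupport ζ → z ∈ U ∧ w ∈ Metric.ball 0 1) :
    |S| / S * ((∫ p, ζ p) * (∫ z in U, f z * ψ z) -
        ∫ z in U, f z * (timeMarginal ψ (z.1 + S) * ζ z.2)) ≤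
      volume.real (Metric.ball (0 : Vel d × Vel d) 1) *
        (c₀ * (6 + 20 / (3 * |S|)) + 3 * |S| * (c₁ * (3 * |S| + 5)) * Λ) * ∫ z in U, ‖g z‖ := by
  set B := Metric.ball (0 : Vel d × Vel d) 1 with hB
  set Ω : Set ((Vel d × Vel d) × ℝ) := B ×ˢ Ioc (0 : ℝ) 1 with hΩ
  have hΩb : Bornology.IsBounded Ω := Metric.isBounded_ball.prod (Metric.isBounded_Ioc 0 1)
  have hΩm : MeasurableSet Ω := Metric.isOpen_ball.measurableSet.prod measurableSet_Ioc
  have hΩv : volume.real Ω = volume.real B := by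
    rw [hΩ, Measure.volume_eq_prod, Measure.real, Measure.prod_prod]; simp [Measure.real]
  have hΩf : volume Ω < ⊤ := hΩb.measure_lt_top
  have hH := (contDiff_bridge hψ hζ S).continuous
  have hD := (contDiff_bridge hψ hζ S).continuous_fderiv (by simp)
  set h : Phase d → Vel d := fun z => (A z).toEuclideanLin (g z) with hh
  have hhi : IntegrableOn h U := hA.integrableOn hf.weakGrad.integrable_grad
  have ia : Integrable (fun q : ((Vel d × Vel d) × ℝ) × Phase d =>
      fderiv ℝ (bridge ψ ζ S) q ((0, 1), 0) * f q.2)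
      ((volume.restrict Ω).prod (volume.restrict U)) :=
    integrable_clm_apply hΩb hΩm hU hUm
      (K := fun q => fderiv ℝ (bridge ψ ζ S) q ((0, 1), 0) • ContinuousLinearMap.id ℝ ℝ)
      (by fun_prop) hf.weakGrad.integrable_fun
  have ib : Integrable (fun q : ((Vel d × Vel d) × ℝ) × Phase d =>
      bridge ψ ζ S q * inner ℝ (steer S q.1) (g q.2))
      ((volume.restrict Ω).prod (volume.restrict U)) :=
    integrable_clm_apply hΩb hΩm hU hUm
      (K := fun q => bridge ψ ζ S q • innerSL ℝ (steer S q.1))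
      (hH.smul ((innerSL ℝ).continuous.comp ((continuous_steer S).comp continuous_fst)))
      hf.weakGrad.integrable_grad
  have ic : Integrable (fun q : ((Vel d × Vel d) × ℝ) × Phase d =>
      q.1.2 ^ 2 * fderiv ℝ (bridge ψ ζ S) q (0, (0, 0, h q.2)))
      ((volume.restrict Ω).prod (volume.restrict U)) :=
    integrable_clm_apply hΩb hΩm hU hUm
      (K := fun q => q.1.2 ^ 2 • (fderiv ℝ (bridge ψ ζ S) q).comp
        ((ContinuousLinearMap.inr ℝ ((Vel d × Vel d) × ℝ) (Phase d)).comp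
          ((ContinuousLinearMap.inr ℝ ℝ (Vel d × Vel d)).comp
            (ContinuousLinearMap.inr ℝ (Vel d) (Vel d)))))
      ((by fun_prop : Continuous fun q : ((Vel d × Vel d) × ℝ) × Phase d => q.1.2 ^ 2).smul
        (hD.clm_comp continuous_const)) hhi
  have hpt : ∀ p ∈ Ω, -(|S| / S) * ∫ z in U, fderiv ℝ (bridge ψ ζ S) (p, z) ((0, 1), 0) * f z ≤
      |S| / S * (∫ z in U, bridge ψ ζ S (p, z) * inner ℝ (steer S p) (g z)) -
      3 * |S| * ∫ z in U, p.2 ^ 2 * fderiv ℝ (bridge ψ ζ S) (p, z) (0, (0, 0, h z)) :=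
    fun p hpΩ => bridge_inequality_pointwise hU hUm hf hψ hζ hS hψ0 hζ0 fun z hz hz' =>
      (hp p.2 ⟨hpΩ.2.1.le, hpΩ.2.2⟩ p.1 z hz hz').1
  have ja := ia.integral_prod_left
  have jb := ib.integral_prod_left
  have jc := ic.integral_prod_left
  have hint := setIntegral_mono_on (ja.const_mul (-(|S| / S)))
    ((jb.const_mul (|S| / S)).sub (jc.const_mul (3 * |S|))) hΩm hpt
  rw [integral_const_mul] at hint
  have hsub := integral_sub (jb.const_mul (|S| / S)) (jc.const_mul (3 * |S|))
  rw [integral_const_mul, integral_const_mul] at hsub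
  have hint' := hint.trans_eq hsub
  have ha : ∫ p in Ω, ∫ z in U, fderiv ℝ (bridge ψ ζ S) (p, z) ((0, 1), 0) * f z =
      (∫ z in U, f z * (timeMarginal ψ (z.1 + S) * ζ z.2)) -
        (∫ p, ζ p) * (∫ z in U, f z * ψ z) := by
    rw [integral_integral_swap ia]
    have e1 : ∀ z, ∫ p in Ω, fderiv ℝ (bridge ψ ζ S) (p, z) ((0, 1), 0) * f z =
        f z * (timeMarginal ψ (z.1 + S) * ζ z.2) - (∫ p, ζ p) * (f z * ψ z) := fun z => by
      rw [integral_mul_const, setIntegral_fderiv_bridge_sigma hψ hζ hψc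
        fun σ hσ w h1 h2 => (hp σ hσ w z h1 h2).2]
      ring
    have i2 := (integrableOn_mul_continuous hU hUm hf.weakGrad.integrable_fun
      hψ.continuous).const_mul (∫ p, ζ p)
    have i1 : IntegrableOn (fun z => f z * (timeMarginal ψ (z.1 + S) * ζ z.2)) U := by
      have := ia.integral_prod_right
      simp only [e1] at this
      exact (this.add i2).congr (Filter.Eventually.of_forall fun z => sub_add_cancel _ _)
    simp only [e1]
    rw [integral_sub i1 i2, integral_const_mul]
  have hb : |∫ p in Ω, ∫ z in U, bridge ψ ζ S (p, z) * inner ℝ (steer S p) (g z)| ≤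
      c₀ * (6 + 20 / (3 * |S|)) * (∫ z in U, ‖g z‖) * volume.real B := by
    rw [← hΩv, ← Real.norm_eq_abs]
    exact norm_setIntegral_le_of_norm_le_const hΩf fun p hpΩ =>
      abs_setIntegral_bridge_mul_inner_le hf.weakGrad.integrable_grad hψ0 hψ1 hζ0 hc₀ hpΩ
  have hc : |∫ p in Ω, ∫ z in U, p.2 ^ 2 * fderiv ℝ (bridge ψ ζ S) (p, z) (0, (0, 0, h z))| ≤
      (c₁ * (3 * |S| + 5)) * volume.real B * Λ * ∫ z in U, ‖g z‖ := by
    -- The order of integration matters: the average over controls must be taken first, at fixed `z`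
    -- and in the fixed direction `A ∇_v f (z)`, for the derivative of `ψ` to cancel.
    rw [integral_integral_swap ic, ← integral_const_mul, ← Real.norm_eq_abs]
    refine norm_integral_le_of_norm_le (hf.weakGrad.integrable_grad.norm.const_mul _) ?_
    filter_upwards [hA.norm_le g] with z hz
    have hc10 : 0 ≤ c₁ := (norm_nonneg _).trans (hc₁ 0)
    refine (abs_setIntegral_fderiv_bridge_velocity_le hψ hζ hS
      (fun σ hσ w h1 h2 => (hp σ hσ w z h1 h2).2) hψ0 hψ1 hc₁ (h z)).trans ?_
    have : 0 ≤ (c₁ * (3 * |S| + 5)) * volume.real B := by positivity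
    calc c₁ * ((3 * |S| + 5) * ‖h z‖) * volume.real B
        = (c₁ * (3 * |S| + 5)) * volume.real B * ‖h z‖ := by ring
      _ ≤ (c₁ * (3 * |S| + 5)) * volume.real B * (Λ * ‖g z‖) := mul_le_mul_of_nonneg_left hz this
      _ = _ := by ring
  simp only at hint'
  rw [ha] at hint'
  have hs1 : |(|S| / S)| = 1 := by rw [abs_div, abs_abs, div_self (abs_ne_zero.2 hS)]
  have hb' := (le_abs_self _).trans_eq (abs_mul (|S| / S)
    (∫ p in Ω, ∫ z in U, bridge ψ ζ S (p, z) * inner ℝ (steer S p) (g z)))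
  rw [hs1, one_mul] at hb'
  have hc' := mul_le_mul_of_nonneg_left ((neg_le_abs _).trans hc)
    (by positivity : 0 ≤ 3 * |S|)
  linarith

end Bridge

/-! ### Comparison of the masses weighted by the fixed profile at different times. -/

/-- A nonnegative profile interpolating in time between two densities. -/
theorem exists_time_profile {p q : ℝ → ℝ} (hp : ContDiff ℝ ∞ p) (hq : ContDiff ℝ ∞ q)
    (hp0 : ∀ t, 0 ≤ p t) (hq0 : ∀ t, 0 ≤ q t) {α τ β : ℝ} (hατ : α ≤ τ) (hτβ : τ ≤ β)
    (hps : ∀ t, t ∉ Ioo τ β → p t = 0) (hqs : ∀ t, t ∉ Ioo α τ → q t = 0) :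
    ∃ k : ℝ → ℝ, ContDiff ℝ ∞ k ∧ (∀ t, deriv k t = (∫ s, p s) * q t - (∫ s, q s) * p t) ∧
      (∀ t, 0 ≤ k t) ∧ (∀ t, k t ≤ (∫ s, p s) * ∫ s, q s) ∧ ∀ t, t ∉ Icc α β → k t = 0 := by
  have ip : Integrable p := hp.continuous.integrable_of_hasCompactSupport
    (HasCompactSupport.intro (isCompact_Icc (a := τ) (b := β))
      fun t ht => hps t fun h => ht (Ioo_subset_Icc_self h))
  have iq : Integrable q := hq.continuous.integrable_of_hasCompactSupport
    (HasCompactSupport.intro (isCompact_Icc (a := α) (b := τ))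
      fun t ht => hqs t fun h => ht (Ioo_subset_Icc_self h))
  set P := ∫ s, p s with hP
  set Q := ∫ s, q s with hQ
  have hP0 : 0 ≤ P := integral_nonneg hp0
  have hQ0 : 0 ≤ Q := integral_nonneg hq0
  have vanish : ∀ {r : ℝ → ℝ} {c t : ℝ}, α ≤ c → (∀ s ≤ c, r s = 0) → t ≤ c →
      ∫ s in α..t, r s = 0 := by
    intro r c t hc hr ht
    rw [intervalIntegral.integral_congr (g := fun _ => 0), intervalIntegral.integral_zero]
    intro s hs
    exact hr s (hs.2.trans (sup_le hc ht))
  have full : ∀ {r : ℝ → ℝ} {c t : ℝ}, (∀ s, s ∉ Ioo α c → r s = 0) → α ≤ t → c ≤ t →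
      ∫ s in α..t, r s = ∫ s, r s := by
    intro r c t hr hα hc
    rw [intervalIntegral.integral_of_le hα, setIntegral_eq_integral_of_forall_compl_eq_zero]
    exact fun s hs => hr s fun h => hs ⟨h.1, h.2.le.trans hc⟩
  have nonneg : ∀ {r : ℝ → ℝ} {t : ℝ}, (∀ s, 0 ≤ r s) → α ≤ t → 0 ≤ ∫ s in α..t, r s :=
    fun hr ht => intervalIntegral.integral_nonneg ht fun s _ => hr s
  have le : ∀ {r : ℝ → ℝ} {t : ℝ}, (∀ s, 0 ≤ r s) → Integrable r → α ≤ t →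
      ∫ s in α..t, r s ≤ ∫ s, r s := by
    intro r t hr hi ht
    rw [intervalIntegral.integral_of_le ht]
    exact setIntegral_le_integral hi (Filter.Eventually.of_forall hr)
  have hps' : ∀ s, s ∉ Ioo α β → p s = 0 := fun s hs =>
    hps s fun h => hs ⟨hατ.trans_lt h.1, h.2⟩
  have a0 : ∀ t ≤ τ, ∫ s in α..t, p s = 0 := fun t ht =>
    vanish hατ (fun s hs => hps s fun h => h.1.not_ge hs) ht
  have b0 : ∀ t ≤ α, ∫ s in α..t, q s = 0 := fun t ht =>
    vanish le_rfl (fun s hs => hqs s fun h => h.1.not_ge hs) ht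
  have hd : ∀ t, HasDerivAt (fun t => P * (∫ s in α..t, q s) - Q * ∫ s in α..t, p s)
      (P * q t - Q * p t) t := fun t =>
    ((hq.continuous.integral_hasStrictDerivAt α t).hasDerivAt.const_mul P).sub
      ((hp.continuous.integral_hasStrictDerivAt α t).hasDerivAt.const_mul Q)
  have hd' : deriv (fun t => P * (∫ s in α..t, q s) - Q * ∫ s in α..t, p s) =
      fun t => P * q t - Q * p t := funext fun t => (hd t).deriv
  -- Since `q` lives before `τ` and `p` after it, this function first grows from `0` to `P Q` and
  -- then decreases back to `0`. The order of the two densities is what makes it nonnegative.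
  refine ⟨fun t => P * (∫ s in α..t, q s) - Q * ∫ s in α..t, p s, ?_, fun t => (hd t).deriv,
    fun t => ?_, fun t => ?_, fun t ht => ?_⟩
  · rw [contDiff_infty_iff_deriv]
    refine ⟨fun t => (hd t).differentiableAt, ?_⟩
    rw [hd']
    fun_prop
  · simp only
    rcases le_total t α with h | h
    · rw [a0 t (h.trans hατ), b0 t h]; simp
    · rcases le_total t τ with h' | h'
      · rw [a0 t h']
        have := mul_nonneg hP0 (nonneg hq0 h)
        simpa using this
      · rw [full hqs h h', ← hQ]
        have := mul_le_mul_of_nonneg_left (le hp0 ip h) hQ0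
        linarith
  · simp only
    rcases le_total t α with h | h
    · rw [a0 t (h.trans hατ), b0 t h]
      have := mul_nonneg hP0 hQ0
      simpa using this
    · have h1 := mul_le_mul_of_nonneg_left (le hq0 iq h) hP0
      have h2 := mul_nonneg hQ0 (nonneg hp0 h)
      linarith
  · simp only
    rw [mem_Icc, not_and_or, not_le, not_le] at ht
    rcases ht with h | h
    · rw [a0 t (h.le.trans hατ), b0 t h.le]; simp
    · rw [full hqs (hατ.trans (hτβ.trans h.le)) (hτβ.trans h.le),
        full hps' (hατ.trans (hτβ.trans h.le)) h.le]
      ring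

theorem expNegInvGlue_deriv_pos {x : ℝ} (hx : 0 < x) : 0 < deriv expNegInvGlue x := by
  have h1 : HasDerivAt (fun y : ℝ => Real.exp (-y⁻¹)) (Real.exp (-x⁻¹) * -(-(x ^ 2)⁻¹)) x :=
    ((hasDerivAt_inv hx.ne').neg).exp
  have h2 : expNegInvGlue =ᶠ[nhds x] fun y : ℝ => Real.exp (-y⁻¹) := by
    filter_upwards [lt_mem_nhds hx] with y hy
    simp [expNegInvGlue, not_le.2 hy]
  rw [(h1.congr_of_eventuallyEq h2).deriv, neg_neg]
  positivity

theorem expNegInvGlue_deriv_eq_zero {x : ℝ} (hx : x ≤ 0) : deriv expNegInvGlue x = 0 := by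
  refine IsLocalMin.deriv_eq_zero (Filter.Eventually.of_forall fun y => ?_)
  rw [expNegInvGlue.zero_of_nonpos hx]
  exact expNegInvGlue.nonneg y

/-- A cutoff `b` such that `v b(v)` is the gradient of a compactly supported function. -/
theorem exists_radial_cutoff (d : ℕ) {ρ : ℝ} (hρ : 0 < ρ) :
    ∃ b Z : Vel d → ℝ, ContDiff ℝ ∞ b ∧ ContDiff ℝ ∞ Z ∧ (∀ v, 0 ≤ b v) ∧ 0 < b 0 ∧
      (∀ v, v ∉ Metric.closedBall 0 ρ → b v = 0) ∧ (∀ v, v ∉ Metric.closedBall 0 ρ → Z v = 0) ∧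
      ∀ v e, fderiv ℝ Z v e = inner ℝ v e * b v := by
  have hE : ContDiff ℝ ∞ expNegInvGlue := expNegInvGlue.contDiff
  have hE' : ContDiff ℝ ∞ (deriv expNegInvGlue) := (contDiff_infty_iff_deriv.1 hE).2
  have hn : ContDiff ℝ ∞ fun v : Vel d => ρ ^ 2 - ‖v‖ ^ 2 := contDiff_const.sub (contDiff_norm_sq ℝ)
  have hneg : ∀ v : Vel d, v ∉ Metric.closedBall 0 ρ → ρ ^ 2 - ‖v‖ ^ 2 ≤ 0 := fun v hv => by
    rw [mem_closedBall_zero_iff, not_le] at hv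
    nlinarith
  -- The gradient of a radial function is parallel to `v`. The factor `-1/2` cancels the derivative
  -- of `-‖v‖²`, and monotonicity of the glue function makes `b` nonnegative.
  refine ⟨fun v => deriv expNegInvGlue (ρ ^ 2 - ‖v‖ ^ 2),
    fun v => -(1 / 2) * expNegInvGlue (ρ ^ 2 - ‖v‖ ^ 2), hE'.comp hn,
    contDiff_const.mul (hE.comp hn), fun v => expNegInvGlue.monotone.deriv_nonneg, ?_,
    fun v hv => expNegInvGlue_deriv_eq_zero (hneg v hv), fun v hv => ?_, fun v e => ?_⟩
  · exact expNegInvGlue_deriv_pos (by simpa using pow_pos hρ 2)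
  · simp [expNegInvGlue.zero_of_nonpos (hneg v hv)]
  · have h1 : HasFDerivAt (fun v : Vel d => ρ ^ 2 - ‖v‖ ^ 2) (-(2 • innerSL ℝ v)) v :=
      (hasStrictFDerivAt_norm_sq v).hasFDerivAt.const_sub _
    have h2 := (((hE.differentiable (by simp) _).hasDerivAt.comp_hasFDerivAt v h1).const_mul
      (-(1 / 2)))
    have h3 : fderiv ℝ (fun v : Vel d => -(1 / 2) * expNegInvGlue (ρ ^ 2 - ‖v‖ ^ 2)) v = _ :=
      h2.fderiv
    rw [h3]
    simp
    ring

section Product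

variable {k : ℝ → ℝ} {a b : Vel d → ℝ}

theorem contDiff_product (hk : ContDiff ℝ ∞ k) (ha : ContDiff ℝ ∞ a) (hb : ContDiff ℝ ∞ b) :
    ContDiff ℝ ∞ fun z : Phase d => k z.1 * (a z.2.1 * b z.2.2) := by fun_prop

theorem fderiv_product (hk : ContDiff ℝ ∞ k) (ha : ContDiff ℝ ∞ a) (hb : ContDiff ℝ ∞ b)
    (z h : Phase d) :
    fderiv ℝ (fun z : Phase d => k z.1 * (a z.2.1 * b z.2.2)) z h =
      deriv k z.1 * h.1 * (a z.2.1 * b z.2.2) +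
        k z.1 * (fderiv ℝ a z.2.1 h.2.1 * b z.2.2 + a z.2.1 * fderiv ℝ b z.2.2 h.2.2) := by
  have h0 : HasDerivAt (fun s : ℝ => z + s • h) h 0 := by
    simpa using ((hasDerivAt_id (0 : ℝ)).smul_const h).const_add z
  have e0 : z + (0 : ℝ) • h = z := by rw [zero_smul, add_zero]
  refine fderiv_apply_eq_of_hasDerivAt
    ((contDiff_product hk ha hb).differentiable (by simp)) h0 e0 ?_
  have h1 := hasDerivAt_mul_comp (ha.differentiable (by simp)) (hb.differentiable (by simp))
    h0.snd_comp.fst_comp h0.snd_comp.snd_comp (a₀ := z.2.1) (b₀ := z.2.2) (by rw [e0]) (by rw [e0])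
  have h2 : HasDerivAt (fun s : ℝ => k (z + s • h).1) (deriv k z.1 * h.1) 0 := by
    have := (hk.differentiable (by simp) (z + (0 : ℝ) • h).1).hasDerivAt.comp 0 h0.fst_comp
    rwa [e0] at this
  have := h2.mul h1
  rwa [e0] at this

theorem isTestFun_product (hk : ContDiff ℝ ∞ k) (ha : ContDiff ℝ ∞ a) (hb : ContDiff ℝ ∞ b)
    {α β ρ₁ ρ₂ : ℝ} (hks : ∀ t, t ∉ Icc α β → k t = 0)
    (has : ∀ x, x ∉ Metric.closedBall 0 ρ₁ → a x = 0)
    (hbs : ∀ v, v ∉ Metric.closedBall 0 ρ₂ → b v = 0) {U : Set (Phase d)}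
    (hU : Icc α β ×ˢ (Metric.closedBall 0 ρ₁ ×ˢ Metric.closedBall 0 ρ₂) ⊆ U) :
    IsTestFun U fun z => k z.1 * (a z.2.1 * b z.2.2) := by
  have hK : IsCompact (Icc α β ×ˢ (Metric.closedBall (0 : Vel d) ρ₁ ×ˢ
      Metric.closedBall (0 : Vel d) ρ₂)) :=
    isCompact_Icc.prod ((isCompact_closedBall 0 ρ₁).prod (isCompact_closedBall 0 ρ₂))
  have h0 : ∀ z : Phase d, z ∉ Icc α β ×ˢ (Metric.closedBall (0 : Vel d) ρ₁ ×ˢ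
      Metric.closedBall (0 : Vel d) ρ₂) → k z.1 * (a z.2.1 * b z.2.2) = 0 := fun z hz => by
    simp only [mem_prod, not_and_or] at hz
    rcases hz with h | h | h
    · simp [hks _ h]
    · simp [has _ h]
    · simp [hbs _ h]
  refine ⟨contDiff_product hk ha hb, HasCompactSupport.intro hK h0, ?_⟩
  refine (closure_minimal (fun z hz => ?_) hK.isClosed).trans hU
  by_contra hc
  exact hz (h0 z hc)

/-- Comparison of the masses seen by `a b` at different times. -/
theorem time_inequality {U : Set (Phase d)} (hU : Bornology.IsBounded U)
    (hUm : MeasurableSet U) {Λ : ℝ} {A : Phase d → Matrix (Fin d) (Fin d) ℝ}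
    (hA : IsBoundedCoeff U Λ A) {f : Phase d → ℝ} {g : Phase d → Vel d}
    (hf : IsWeakSubsolution U A f g) (hk : ContDiff ℝ ∞ k) (ha : ContDiff ℝ ∞ a)
    (hb : ContDiff ℝ ∞ b) {Z : Vel d → ℝ} (hZ : ContDiff ℝ ∞ Z)
    (hbZ : ∀ v e, fderiv ℝ Z v e = inner ℝ v e * b v) {α β ρ₁ ρ₂ : ℝ}
    (hks : ∀ t, t ∉ Icc α β → k t = 0) (has : ∀ x, x ∉ Metric.closedBall 0 ρ₁ → a x = 0)
    (hbs : ∀ v, v ∉ Metric.closedBall 0 ρ₂ → b v = 0)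
    (hZs : ∀ v, v ∉ Metric.closedBall 0 ρ₂ → Z v = 0)
    (hsub : Icc α β ×ˢ (Metric.closedBall 0 ρ₁ ×ˢ Metric.closedBall 0 ρ₂) ⊆ U)
    (hk0 : ∀ t, 0 ≤ k t) (ha0 : ∀ x, 0 ≤ a x) (hb0 : ∀ v, 0 ≤ b v) {K c₁ c₂ : ℝ}
    (hK : ∀ t, k t ≤ K) (hc₁ : ∀ x v, a x * ‖fderiv ℝ b v‖ ≤ c₁)
    (hc₂ : ∀ x v, ‖fderiv ℝ a x‖ * |Z v| ≤ c₂) :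
    -∫ z in U, f z * (deriv k z.1 * (a z.2.1 * b z.2.2)) ≤
      K * (c₁ * Λ + d * c₂) * ∫ z in U, ‖g z‖ := by
  have hK0 : 0 ≤ K := (hk0 0).trans (hK 0)
  have hfi := hf.weakGrad.integrable_fun
  have hgi := hf.weakGrad.integrable_grad
  have h1 := hf.integral_fderiv_le (isTestFun_product hk ha hb hks has hbs hsub)
    fun z => mul_nonneg (hk0 _) (mul_nonneg (ha0 _) (hb0 _))
  simp only [fderiv_product hk ha hb, mul_one, mul_zero, zero_mul, map_zero, add_zero,
    zero_add] at h1
  have hcdk : Continuous (deriv k) := hk.continuous_deriv (by simp)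
  have hcda : Continuous (fderiv ℝ a) := ha.continuous_fderiv (by simp)
  have hca := ha.continuous
  have hcb := hb.continuous
  have hck := hk.continuous
  have i1 : IntegrableOn (fun z => f z * (deriv k z.1 * (a z.2.1 * b z.2.2))) U :=
    integrableOn_mul_continuous hU hUm hfi (by fun_prop)
  have i2 : IntegrableOn (fun z => f z * (k z.1 * (fderiv ℝ a z.2.1 z.2.2 * b z.2.2))) U :=
    integrableOn_mul_continuous hU hUm hfi (by fun_prop)
  have e1 : ∫ z in U, f z * (deriv k z.1 * (a z.2.1 * b z.2.2) +
      k z.1 * (fderiv ℝ a z.2.1 z.2.2 * b z.2.2)) =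
      (∫ z in U, f z * (deriv k z.1 * (a z.2.1 * b z.2.2))) +
        ∫ z in U, f z * (k z.1 * (fderiv ℝ a z.2.1 z.2.2 * b z.2.2)) := by
    rw [← integral_add i1 i2]
    simp only [mul_add]
  have hdiff : |∫ z in U, k z.1 * (a z.2.1 * fderiv ℝ b z.2.2 ((A z).toEuclideanLin (g z)))| ≤
      K * c₁ * Λ * ∫ z in U, ‖g z‖ := by
    rw [← Real.norm_eq_abs, ← integral_const_mul]
    refine norm_integral_le_of_norm_le (hgi.norm.const_mul _) ?_
    filter_upwards [hA.norm_le g] with z hz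
    rw [norm_mul, norm_mul, Real.norm_of_nonneg (hk0 _), Real.norm_of_nonneg (ha0 _)]
    have hc10 : 0 ≤ c₁ := (mul_nonneg (ha0 0) (norm_nonneg (fderiv ℝ b 0))).trans (hc₁ 0 0)
    calc k z.1 * (a z.2.1 * ‖fderiv ℝ b z.2.2 ((A z).toEuclideanLin (g z))‖)
        ≤ k z.1 * (a z.2.1 * (‖fderiv ℝ b z.2.2‖ * ‖(A z).toEuclideanLin (g z)‖)) :=
          mul_le_mul_of_nonneg_left (mul_le_mul_of_nonneg_left
            ((fderiv ℝ b z.2.2).le_opNorm _) (ha0 _)) (hk0 _)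
      _ = k z.1 * ((a z.2.1 * ‖fderiv ℝ b z.2.2‖) * ‖(A z).toEuclideanLin (g z)‖) := by ring
      _ ≤ K * (c₁ * (Λ * ‖g z‖)) :=
          mul_le_mul (hK _) (mul_le_mul (hc₁ _ _) hz (norm_nonneg _) hc10)
            (mul_nonneg (mul_nonneg (ha0 _) (norm_nonneg _)) (norm_nonneg _)) hK0
      _ = _ := by ring
  have htr : |∫ z in U, f z * (k z.1 * (fderiv ℝ a z.2.1 z.2.2 * b z.2.2))| ≤
      K * (d * c₂) * ∫ z in U, ‖g z‖ := by
    set E := EuclideanSpace.basisFun (Fin d) ℝ with hE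
    have hai : ∀ i, ContDiff ℝ ∞ fun x => fderiv ℝ a x (E i) := fun i =>
      (ha.fderiv_right (m := ∞) (by simp)).clm_apply contDiff_const
    have hais : ∀ i x, x ∉ Metric.closedBall 0 ρ₁ → fderiv ℝ a x (E i) = 0 := fun i x hx => by
      have : x ∉ tsupport a := fun h => hx (closure_minimal (fun y hy => by
        by_contra hc
        exact hy (has y hc)) Metric.isClosed_closedBall h)
      have : fderiv ℝ a x = 0 := by
        by_contra hne
        exact this (support_fderiv_subset ℝ hne)
      simp [this]
    -- In coordinates `v · ∇a b = ∑ ∂ᵢa ∂ᵢZ`, so each summand is the `i`-th velocity derivative of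
    -- the test function `k ∂ᵢa Z`, and the definition of the weak gradient transfers it to `f`.
    have hi : ∀ i, ∫ z in U, f z * (k z.1 * (fderiv ℝ a z.2.1 (E i) *
        (inner ℝ z.2.2 (E i) * b z.2.2))) =
        -∫ z in U, k z.1 * (fderiv ℝ a z.2.1 (E i) * Z z.2.2) * inner ℝ (E i) (g z) := fun i => by
      have := hf.weakGrad.integral_mul_fderiv hU hUm
        (isTestFun_product hk (hai i) hZ hks (hais i) hZs hsub) (E i)
      simpa only [fderiv_product hk (hai i) hZ, mul_zero, zero_mul, map_zero, zero_add, hbZ]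
        using this
    have hib : ∀ i, |∫ z in U, f z * (k z.1 * (fderiv ℝ a z.2.1 (E i) *
        (inner ℝ z.2.2 (E i) * b z.2.2)))| ≤ K * c₂ * ∫ z in U, ‖g z‖ := fun i => by
      rw [hi, abs_neg, ← Real.norm_eq_abs, ← integral_const_mul]
      refine norm_integral_le_of_norm_le (hgi.norm.const_mul _)
        (Filter.Eventually.of_forall fun z => ?_)
      have hEi : ‖E i‖ = 1 := E.orthonormal.1 i
      rw [norm_mul, norm_mul, norm_mul, Real.norm_of_nonneg (hk0 _), Real.norm_eq_abs (Z _)]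
      have n1 : ‖fderiv ℝ a z.2.1 (E i)‖ ≤ ‖fderiv ℝ a z.2.1‖ := by
        simpa [hEi] using (fderiv ℝ a z.2.1).le_opNorm (E i)
      have n2 : ‖inner ℝ (E i) (g z)‖ ≤ ‖g z‖ := by
        simpa [hEi] using norm_inner_le_norm (𝕜 := ℝ) (E i) (g z)
      have n3 : ‖fderiv ℝ a z.2.1 (E i)‖ * |Z z.2.2| ≤ c₂ :=
        (mul_le_mul_of_nonneg_right n1 (abs_nonneg _)).trans (hc₂ _ _)
      have n4 : 0 ≤ c₂ := (mul_nonneg (norm_nonneg _) (abs_nonneg _)).trans n3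
      exact mul_le_mul (mul_le_mul (hK _) n3 (by positivity) hK0) n2 (norm_nonneg _)
        (by positivity)
    have ii : ∀ i ∈ Finset.univ, IntegrableOn (fun z => f z * (k z.1 * (fderiv ℝ a z.2.1 (E i) *
        (inner ℝ z.2.2 (E i) * b z.2.2)))) U := fun i _ =>
      integrableOn_mul_continuous hU hUm hfi (by fun_prop)
    have hs : ∀ z : Phase d, f z * (k z.1 * (fderiv ℝ a z.2.1 z.2.2 * b z.2.2)) =
        ∑ i, f z * (k z.1 * (fderiv ℝ a z.2.1 (E i) * (inner ℝ z.2.2 (E i) * b z.2.2))) :=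
      fun z => by
        have : fderiv ℝ a z.2.1 z.2.2 = ∑ i, inner ℝ z.2.2 (E i) * fderiv ℝ a z.2.1 (E i) := by
          conv_lhs => rw [← E.sum_repr' z.2.2]
          simp only [map_sum, map_smul, smul_eq_mul, real_inner_comm]
        rw [this, Finset.sum_mul, Finset.mul_sum, Finset.mul_sum]
        exact Finset.sum_congr rfl fun i _ => by ring
    simp only [hs]
    rw [integral_finsetSum _ ii]
    refine (Finset.abs_sum_le_sum_abs _ _).trans ((Finset.sum_le_sum fun i _ => hib i).trans ?_)
    rw [Finset.sum_const, Finset.card_univ, Fintype.card_fin, nsmul_eq_mul]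
    apply le_of_eq
    ring
  rw [e1] at h1
  have := (le_abs_self _).trans htr
  have := (neg_le_abs _).trans hdiff
  linarith

end Product

/-! ### Time marginals and smooth approximation of indicators. -/

/-- The time marginal of a smooth compactly supported function is smooth. -/
theorem contDiff_timeMarginal {ψ : Phase d → ℝ} (hψ : ContDiff ℝ ∞ ψ)
    (hψc : HasCompactSupport ψ) : ContDiff ℝ ∞ (timeMarginal ψ) := by
  -- The marginal is the convolution of the constant `1` with `p ↦ ψ(t, -p)`, evaluated at `0`; the
  -- smooth dependence on the parameter `t` is then known.
  have h := contDiffOn_convolution_right_with_param (𝕜 := ℝ) (n := ⊤)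
    (μ := (volume : Measure (Vel d × Vel d)))
    (f := fun _ : Vel d × Vel d => (1 : ℝ)) (ContinuousLinearMap.mul ℝ ℝ)
    (g := fun (t : ℝ) (p : Vel d × Vel d) => ψ (t, -p)) (s := univ)
    (k := (fun z : Phase d => -z.2) '' tsupport ψ) isOpen_univ
    (hψc.isCompact.image (by fun_prop))
    (fun t p _ hp => image_eq_zero_of_notMem_tsupport fun h => hp ⟨_, h, neg_neg p⟩)
    (locallyIntegrable_const 1)
    (hψ.comp (by fun_prop : ContDiff ℝ ∞ fun q : ℝ × (Vel d × Vel d) => (q.1, -q.2))).contDiffOn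
  rw [univ_prod_univ, contDiffOn_univ] at h
  have h2 := h.comp (f := fun t : ℝ => (t, (0 : Vel d × Vel d))) (by fun_prop)
  convert h2 using 1
  ext t
  simp [timeMarginal, convolution]

theorem integral_timeMarginal {ψ : Phase d → ℝ} (hψ : Integrable ψ) :
    ∫ t, timeMarginal ψ t = ∫ z, ψ z := by
  rw [Measure.volume_eq_prod] at hψ ⊢
  exact (integral_prod ψ hψ).symm

/-- Smooth approximation of the indicator function of a measurable subset of an open set. -/
theorem exists_smooth_approx {X : Type*} [NormedAddCommGroup X] [NormedSpace ℝ X]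
    [FiniteDimensional ℝ X] [MeasurableSpace X] [BorelSpace X] {μ : Measure X} [μ.IsAddHaarMeasure]
    {W U E : Set X} (hU : IsOpen U) (hE : MeasurableSet E) (hEU : E ⊆ U) (hUW : U ⊆ W)
    (hWf : μ W ≠ ⊤) {f : X → ℝ} (hf : IntegrableOn f W μ) {ε : ℝ}
    (hε : 0 < ε) :
    ∃ ψ : X → ℝ, ContDiff ℝ ∞ ψ ∧ HasCompactSupport ψ ∧ tsupport ψ ⊆ U ∧ (∀ z, 0 ≤ ψ z) ∧
      (∀ z, ψ z ≤ 1) ∧ |∫ z in W, f z * ψ z ∂μ - ∫ z in E, f z ∂μ| ≤ ε ∧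
      |∫ z, ψ z ∂μ - μ.real E| ≤ ε := by
  have hEf : μ E ≠ ⊤ := measure_ne_top_of_subset (hEU.trans hUW) hWf
  -- Absolute continuity of the integral is used for `f` and for the constant `1` together, so that
  -- one `ψ` approximates both the mass of `f` on `E` and the volume of `E`.
  obtain ⟨δ₁, hδ₁, hδ₁'⟩ := exists_pos_setLIntegral_lt_of_measure_lt hf.2.ne
    (ENNReal.ofReal_pos.2 hε).ne'
  have h1W : IntegrableOn (fun _ : X => (1 : ℝ)) W μ := integrableOn_const hWf
  obtain ⟨δ₂, hδ₂, hδ₂'⟩ := exists_pos_setLIntegral_lt_of_measure_lt h1W.2.ne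
    (ENNReal.ofReal_pos.2 hε).ne'
  set δ := min δ₁ δ₂ with hδ
  have hδ0 : δ / 2 ≠ 0 := (ENNReal.half_pos (lt_min hδ₁ hδ₂).ne').ne'
  obtain ⟨V, hEV, hVo, -, hVE⟩ := hE.exists_isOpen_sdiff_lt hEf hδ0
  obtain ⟨K, hKE, hK, hEK⟩ := hE.exists_isCompact_sdiff_lt hEf hδ0
  obtain ⟨K', hK', hKK', hK'V⟩ := exists_compact_between hK (hVo.inter hU)
    (fun z hz => ⟨hEV (hKE hz), hEU (hKE hz)⟩)
  obtain ⟨ψ, hψ, hψr, hψs, hψ1⟩ := exists_contMDiff_support_eq_eq_one_iff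
    (modelWithCornersSelf ℝ X) (n := ⊤) isOpen_interior hK.isClosed hKK'
  have hr : ∀ z, ψ z ∈ Icc (0 : ℝ) 1 := fun z => hψr (mem_range_self z)
  have hts : tsupport ψ ⊆ K' := by
    rw [tsupport, hψs]
    exact closure_minimal interior_subset hK'.isClosed
  have hc : HasCompactSupport ψ := hK'.of_isClosed_subset (isClosed_tsupport _) hts
  have hψd : ContDiff ℝ ∞ ψ := contMDiff_iff_contDiff.1 hψ
  -- With `K ⊆ E ⊆ V`, the function `ψ` agrees with the indicator of `E` off `D`, and differs from
  -- it by at most `1` on `D`.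
  set D := V \ K with hD
  have hDm : MeasurableSet D := hVo.measurableSet.diff hK.measurableSet
  have hDδ : μ.restrict W D < δ := by
    refine (Measure.restrict_apply_le W D).trans_lt ?_
    calc μ D ≤ μ (V \ E ∪ E \ K) := measure_mono fun z hz => by
            by_cases h : z ∈ E
            · exact Or.inr ⟨h, hz.2⟩
            · exact Or.inl ⟨hz.1, h⟩
      _ ≤ μ (V \ E) + μ (E \ K) := measure_union_le _ _
      _ < δ / 2 + δ / 2 := ENNReal.add_lt_add hVE hEK
      _ = δ := ENNReal.add_halves δ
  have hψ0 : ∀ z, z ∉ V ∩ U → ψ z = 0 := fun z hz =>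
    image_eq_zero_of_notMem_tsupport fun h => hz (hK'V (hts h))
  have key : ∀ h : X → ℝ, IntegrableOn h W μ → ∫⁻ z in D, ‖h z‖ₑ ∂(μ.restrict W) <
      ENNReal.ofReal ε → |∫ z in W, h z * ψ z ∂μ - ∫ z in E, h z ∂μ| ≤ ε := by
    intro h hh hlt
    have e1 : ∫ z in E, h z ∂μ = ∫ z in W, E.indicator h z ∂μ := by
      rw [setIntegral_indicator hE, inter_eq_right.2 (hEU.trans hUW)]
    have i1 : IntegrableOn (fun z => h z * ψ z) W μ := by
      refine Integrable.mul_bdd (c := 1) hh hψd.continuous.aestronglyMeasurable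
        (Filter.Eventually.of_forall fun z => ?_)
      rw [Real.norm_of_nonneg (hr z).1]
      exact (hr z).2
    rw [e1, ← integral_sub i1 (hh.indicator hE), ← Real.norm_eq_abs]
    have i2 : Integrable (D.indicator fun z => ‖h z‖) (μ.restrict W) := hh.norm.indicator hDm
    refine (norm_integral_le_of_norm_le i2 (Filter.Eventually.of_forall fun z => ?_)).trans ?_
    · by_cases hzD : z ∈ D
      · rw [indicator_of_mem hzD]
        by_cases hzE : z ∈ E
        · rw [indicator_of_mem hzE, Real.norm_eq_abs, Real.norm_eq_abs,
            show h z * ψ z - h z = h z * (ψ z - 1) by ring, abs_mul]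
          refine mul_le_of_le_one_right (abs_nonneg _) ?_
          rw [abs_le]; constructor <;> linarith [(hr z).1, (hr z).2]
        · rw [indicator_of_notMem hzE, sub_zero, norm_mul, Real.norm_of_nonneg (hr z).1]
          exact mul_le_of_le_one_right (norm_nonneg _) (hr z).2
      · rw [indicator_of_notMem hzD]
        by_cases hzK : z ∈ K
        · rw [indicator_of_mem (hKE hzK), (hψ1 z).1 hzK]; simp
        · have hzV : z ∉ V := fun h => hzD ⟨h, hzK⟩
          rw [indicator_of_notMem fun h => hzV (hEV h), hψ0 z fun h => hzV h.1]; simp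
    · rw [integral_indicator hDm, integral_norm_eq_lintegral_enorm hh.1.restrict]
      exact ENNReal.toReal_le_of_le_ofReal hε.le hlt.le
  refine ⟨ψ, hψd, hc, hts.trans (hK'V.trans inter_subset_right), fun z => (hr z).1,
    fun z => (hr z).2, key f hf (hδ₁' D (hDδ.trans_le (min_le_left _ _))), ?_⟩
  have := key _ h1W (hδ₂' D (hDδ.trans_le (min_le_right _ _)))
  simp only [one_mul] at this
  rw [setIntegral_eq_integral_of_forall_compl_eq_zero
    fun z hz => hψ0 z fun h => hz (hUW h.2)] at this
  simpa using this

theorem exists_smooth_approx_seq {X : Type*} [NormedAddCommGroup X] [NormedSpace ℝ X]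
    [FiniteDimensional ℝ X] [MeasurableSpace X] [BorelSpace X] {μ : Measure X} [μ.IsAddHaarMeasure]
    {W U E : Set X} (hU : IsOpen U) (hE : MeasurableSet E) (hEU : E ⊆ U) (hUW : U ⊆ W)
    (hWf : μ W ≠ ⊤) {f : X → ℝ} (hf : IntegrableOn f W μ) :
    ∃ ψ : ℕ → X → ℝ, (∀ n, ContDiff ℝ ∞ (ψ n) ∧ HasCompactSupport (ψ n) ∧ tsupport (ψ n) ⊆ U ∧
        (∀ z, 0 ≤ ψ n z) ∧ ∀ z, ψ n z ≤ 1) ∧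
      Filter.Tendsto (fun n => ∫ z in W, f z * ψ n z ∂μ) Filter.atTop (nhds (∫ z in E, f z ∂μ)) ∧
      Filter.Tendsto (fun n => ∫ z, ψ n z ∂μ) Filter.atTop (nhds (μ.real E)) := by
  choose ψ h1 h2 h3 h4 h5 h6 h7 using fun n : ℕ =>
    exists_smooth_approx hU hE hEU hUW hWf hf (Nat.one_div_pos_of_nat (α := ℝ) (n := n))
  refine ⟨ψ, fun n => ⟨h1 n, h2 n, h3 n, h4 n, h5 n⟩, ?_, ?_⟩
  · rw [tendsto_iff_norm_sub_tendsto_zero]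
    exact squeeze_zero (fun _ => norm_nonneg _) h6 tendsto_one_div_add_atTop_nhds_zero_nat
  · rw [tendsto_iff_norm_sub_tendsto_zero]
    exact squeeze_zero (fun _ => norm_nonneg _) h7 tendsto_one_div_add_atTop_nhds_zero_nat

/-! ### Geometry of the cylinders and size of the trajectories. -/

theorem interior_kinCyl (d : ℕ) (r : ℝ) : interior (kinCyl d r) =
    Ioo (-r ^ 2) 0 ×ˢ (Metric.ball 0 (r ^ 3) ×ˢ Metric.ball 0 r) := by
  rw [kinCyl, interior_prod_eq, interior_prod_eq, interior_Ioc, Metric.isOpen_ball.interior_eq,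
    Metric.isOpen_ball.interior_eq]

theorem interior_kinCyl_ae_eq (d : ℕ) (r : ℝ) :
    interior (kinCyl d r) =ᵐ[volume] kinCyl d r := by
  rw [interior_kinCyl, kinCyl]
  exact Measure.set_prod_ae_eq Ioo_ae_eq_Ioc (Filter.EventuallyEq.refl _ _)

theorem norm_smul_le_mul {a A B : ℝ} {x : Vel d} (ha : |a| ≤ A) (hx : ‖x‖ ≤ B) :
    ‖a • x‖ ≤ A * B := by
  rw [norm_smul, Real.norm_eq_abs]
  exact mul_le_mul ha hx (norm_nonneg _) ((abs_nonneg _).trans ha)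

/-- Critical trajectories between small cylinders stay in the unit cylinder and have small
controls. -/
theorem norm_lt_one_of_startPt_endPt {S σ : ℝ} (hS : |S| = 1 / 4000000) (hσ : σ ∈ Icc (0 : ℝ) 1)
    {w : Vel d × Vel d} {z : Phase d} (h1 : ‖(startPt S σ w z).2.1‖ ≤ 1 / 1000000000)
    (h2 : ‖(startPt S σ w z).2.2‖ ≤ 1 / 1000)
    (h3 : ‖(endPt S w (startPt S σ w z)).1‖ ≤ 1 / 1000000000)
    (h4 : ‖(endPt S w (startPt S σ w z)).2‖ ≤ 1 / 1000) :
    ‖z.2.1‖ < 1 ∧ ‖z.2.2‖ < 1 ∧ w ∈ Metric.ball 0 1 := by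
  have hu : ‖w.2‖ ≤ 1 / 500 := by
    have e : w.2 = (endPt S w (startPt S σ w z)).2 - (startPt S σ w z).2.2 := by
      simp [endPt]
    rw [e]
    exact (norm_sub_le _ _).trans (by linarith)
  have hy : ‖w.1‖ ≤ 3 / 1000000000 := by
    have e : w.1 = (endPt S w (startPt S σ w z)).1 - (startPt S σ w z).2.1
        + S • (startPt S σ w z).2.2 := by
      simp only [endPt]; abel
    rw [e]
    have := norm_smul_le_mul hS.le h2
    refine (norm_add_le _ _).trans ((add_le_add (norm_sub_le _ _) le_rfl).trans ?_)
    norm_num at this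
    linarith
  obtain ⟨s0, s1⟩ := hσ
  have p2 : σ ^ 2 ∈ Icc (0 : ℝ) 1 := ⟨by positivity, pow_le_one₀ s0 s1⟩
  have p3 : σ ^ 3 ∈ Icc (0 : ℝ) 1 := ⟨by positivity, pow_le_one₀ s0 s1⟩
  have p4 : σ ^ 4 ∈ Icc (0 : ℝ) 1 := ⟨by positivity, pow_le_one₀ s0 s1⟩
  have p5 : σ ^ 5 ∈ Icc (0 : ℝ) 1 := ⟨by positivity, pow_le_one₀ s0 s1⟩
  have hSle : ∀ {a A : ℝ}, |a| ≤ A → |S * a| ≤ A * (1 / 4000000) := fun h => by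
    rw [abs_mul, hS, mul_comm]
    exact mul_le_mul_of_nonneg_right h (by norm_num)
  have hv : ‖z.2.2‖ ≤ 1 / 2 := by
    have e : z.2.2 = (startPt S σ w z).2.2 - (4 * σ - 5 * σ ^ 2) • w.2
        - (20 / (3 * S) * (σ - σ ^ 2)) • w.1 := by
      simp only [startPt]; abel
    have b1 : |4 * σ - 5 * σ ^ 2| ≤ 5 := by
      rw [abs_le]; constructor <;> linarith [p2.1, p2.2]
    -- The only large coefficient: correcting a position error of order `r³` within a time of order
    -- `r²` costs a velocity of order `r`. Against `‖w.1‖ ≤ 3 · 10⁻⁹` it contributes at most `0.08`.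
    have b2 : |20 / (3 * S) * (σ - σ ^ 2)| ≤ 80000000 / 3 := by
      rw [abs_mul, abs_div, abs_mul, hS]
      have : |σ - σ ^ 2| ≤ 1 := by
        rw [abs_le]; constructor <;> linarith [p2.1, p2.2]
      norm_num
      linarith
    have n1 := norm_smul_le_mul b1 hu
    have n2 := norm_smul_le_mul b2 hy
    rw [e]
    refine (norm_sub_le _ _).trans ((add_le_add (norm_sub_le _ _) le_rfl).trans ?_)
    norm_num at n1 n2 ⊢
    linarith
  refine ⟨?_, by linarith, ?_⟩
  · have e : z.2.1 = (startPt S σ w z).2.1 - (S * σ ^ 3) • z.2.2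
        - (S * (σ ^ 4 - 2 * σ ^ 5)) • w.2 - ((5 * σ ^ 4 - 8 * σ ^ 5) / 3) • w.1 := by
      simp only [startPt]; abel
    have b1 : |S * σ ^ 3| ≤ 1 * (1 / 4000000) := hSle (abs_le.2 ⟨by linarith [p3.1], p3.2⟩)
    have b2 : |S * (σ ^ 4 - 2 * σ ^ 5)| ≤ 2 * (1 / 4000000) :=
      hSle (abs_le.2 ⟨by linarith [p4.1, p5.2], by linarith [p4.2, p5.1]⟩)
    have b3 : |(5 * σ ^ 4 - 8 * σ ^ 5) / 3| ≤ 3 :=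
      abs_le.2 ⟨by linarith [p4.1, p5.2], by linarith [p4.2, p5.1]⟩
    have n1 := norm_smul_le_mul b1 hv
    have n2 := norm_smul_le_mul b2 hu
    have n3 := norm_smul_le_mul b3 hy
    rw [e]
    refine ((norm_sub_le _ _).trans (add_le_add ((norm_sub_le _ _).trans
      (add_le_add (norm_sub_le _ _) le_rfl)) le_rfl)).trans_lt ?_
    norm_num at n1 n2 n3 ⊢
    linarith
  · rw [mem_ball_zero_iff]
    exact (norm_prod_le_iff.2 ⟨hy.trans (by norm_num), hu⟩ : ‖w‖ ≤ 1 / 500).trans_lt (by norm_num)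

instance isAddHaarMeasure_volume_phase : (volume : Measure (Phase d)).IsAddHaarMeasure :=
  Measure.prod.instIsAddHaarMeasure (volume : Measure ℝ) (volume : Measure (Vel d × Vel d))

theorem timeMarginal_eq_zero {ψ : Phase d → ℝ} {I : Set ℝ} {J : Set (Vel d × Vel d)}
    (hψ : tsupport ψ ⊆ I ×ˢ J) {t : ℝ} (ht : t ∉ I) : timeMarginal ψ t = 0 := by
  simp only [timeMarginal]
  rw [integral_eq_zero_of_ae (Filter.Eventually.of_forall fun p => ?_)]
  exact image_eq_zero_of_notMem_tsupport fun h => ht (hψ h).1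

theorem integral_le_measureReal {X : Type*} [TopologicalSpace X] [MeasurableSpace X]
    {μ : Measure X} {ψ : X → ℝ} {U : Set X} (hψ : tsupport ψ ⊆ U)
    (hUf : μ U ≠ ⊤) (hψi : Integrable ψ μ) (hψ1 : ∀ z, ψ z ≤ 1) : ∫ z, ψ z ∂μ ≤ μ.real U := by
  rw [← setIntegral_eq_integral_of_forall_compl_eq_zero (s := U) fun z hz =>
    image_eq_zero_of_notMem_tsupport fun h => hz (hψ h)]
  calc ∫ z in U, ψ z ∂μ ≤ ∫ z in U, (1 : ℝ) ∂μ :=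
        integral_mono hψi.integrableOn (integrableOn_const hUf) hψ1
    _ = μ.real U := by simp

/-! ### The comparison inequality and the conclusion. -/

/-- Comparison of two smooth averages of a subsolution, the second one in the past of the first. -/
theorem exists_comparison (d : ℕ) :
    ∃ M : ℝ, 0 < M ∧ ∀ Λ : ℝ, 0 < Λ → ∃ C : ℝ, 0 ≤ C ∧
      ∀ (A : Phase d → Matrix (Fin d) (Fin d) ℝ) (f : Phase d → ℝ) (g : Phase d → Vel d),
        IsBoundedCoeff (interior (kinCyl d 1)) Λ A →
        IsWeakSubsolution (interior (kinCyl d 1)) A f g →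
        ∀ ψ χ : Phase d → ℝ, ContDiff ℝ ∞ ψ → HasCompactSupport ψ →
          tsupport ψ ⊆ interior (kinCyl d (1 / 1000)) → (∀ z, 0 ≤ ψ z) → (∀ z, ψ z ≤ 1) →
          ContDiff ℝ ∞ χ → HasCompactSupport χ →
          tsupport χ ⊆ pastCyl d (1 / 1000) → (∀ z, 0 ≤ χ z) → (∀ z, χ z ≤ 1) →
          (∫ z, χ z) * (M * ∫ z in interior (kinCyl d 1), f z * ψ z) ≤
            (∫ z, ψ z) * (M * ∫ z in interior (kinCyl d 1), f z * χ z) +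
              C * ∫ z in interior (kinCyl d 1), ‖g z‖ := by
  obtain ⟨b, Z, hb, hZ, hb0, hbpos, hbs, hZs, hbZ⟩ :=
    exists_radial_cutoff d (by norm_num : (0 : ℝ) < 1 / 1000)
  obtain ⟨a, -, ha, -, ha0, hapos, has, -, -⟩ :=
    exists_radial_cutoff d (by norm_num : (0 : ℝ) < 1 / 1000000000)
  have compact : ∀ {ρ : ℝ} {F : Vel d → ℝ}, (∀ v, v ∉ Metric.closedBall 0 ρ → F v = 0) →
      HasCompactSupport F := fun h => HasCompactSupport.intro (isCompact_closedBall _ _) h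
  set ζ : Vel d × Vel d → ℝ := fun p => a p.1 * b p.2 with hζdef
  have hζ : ContDiff ℝ ∞ ζ := by fun_prop
  have hζ0 : ∀ p, 0 ≤ ζ p := fun p => mul_nonneg (ha0 _) (hb0 _)
  have hζs : ∀ p, p ∉ Metric.closedBall (0 : Vel d) (1 / 1000000000) ×ˢ
      Metric.closedBall (0 : Vel d) (1 / 1000) → ζ p = 0 := fun p hp => by
    rw [mem_prod, not_and_or] at hp
    rcases hp with h | h
    · simp [hζdef, has _ h]
    · simp [hζdef, hbs _ h]
  have hζc : HasCompactSupport ζ :=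
    HasCompactSupport.intro ((isCompact_closedBall _ _).prod (isCompact_closedBall _ _)) hζs
  have hζt : tsupport ζ ⊆ Metric.closedBall (0 : Vel d) (1 / 1000000000) ×ˢ
      Metric.closedBall (0 : Vel d) (1 / 1000) :=
    closure_minimal (fun p hp => by_contra fun hc => hp (hζs p hc))
      (Metric.isClosed_closedBall.prod Metric.isClosed_closedBall)
  obtain ⟨c₀, hc₀⟩ := hζc.exists_bound_of_continuous hζ.continuous
  obtain ⟨c₁, hc₁⟩ := (hζc.fderiv ℝ).exists_bound_of_continuous (hζ.continuous_fderiv (by simp))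
  obtain ⟨ka, hka⟩ := (compact has).exists_bound_of_continuous ha.continuous
  obtain ⟨ka', hka'⟩ := ((compact has).fderiv ℝ).exists_bound_of_continuous
    (ha.continuous_fderiv (by simp))
  obtain ⟨kb', hkb'⟩ := ((compact hbs).fderiv ℝ).exists_bound_of_continuous
    (hb.continuous_fderiv (by simp))
  obtain ⟨kZ, hkZ⟩ := (compact hZs).exists_bound_of_continuous hZ.continuous
  have hc₀0 : 0 ≤ c₀ := (norm_nonneg _).trans (hc₀ 0)
  have hc₁0 : 0 ≤ c₁ := (norm_nonneg _).trans (hc₁ 0)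
  have hka0 : 0 ≤ ka := (norm_nonneg _).trans (hka 0)
  have hka'0 : 0 ≤ ka' := (norm_nonneg _).trans (hka' 0)
  have hkb'0 : 0 ≤ kb' := (norm_nonneg _).trans (hkb' 0)
  have hkZ0 : 0 ≤ kZ := (norm_nonneg _).trans (hkZ 0)
  -- The factor `M` is the mass of the intermediate profile; it is positive because `a` and `b` are
  -- positive at the origin.
  refine ⟨∫ p, ζ p, hζ.continuous.integral_pos_of_hasCompactSupport_nonneg_nonzero hζc hζ0
    (x := 0) (mul_pos hapos hbpos).ne', fun Λ hΛ => ?_⟩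
  -- This is `r²/4` for `r = 1/1000`: less than half the time gap `r²` between the cylinders, so
  -- both families of trajectories remain in the past of `0` and the shifted marginals stay disjoint
  -- and ordered.
  set S : ℝ := 1 / 4000000 with hS
  have hS0 : S ≠ 0 := by rw [hS]; norm_num
  have hSabs : |S| = 1 / 4000000 := by rw [hS]; norm_num
  have hSabs' : |-S| = 1 / 4000000 := by rw [abs_neg, hSabs]
  set U := interior (kinCyl d 1) with hUdef
  have hUe : U = Ioo (-1) 0 ×ˢ (Metric.ball 0 1 ×ˢ Metric.ball 0 1) := by
    rw [hUdef, interior_kinCyl]; norm_num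
  have hU : Bornology.IsBounded U := by
    rw [hUe]
    exact (Metric.isBounded_Ioo _ _).prod (Metric.isBounded_ball.prod Metric.isBounded_ball)
  have hUm : MeasurableSet U := isOpen_interior.measurableSet
  have hQe : interior (kinCyl d (1 / 1000)) = Ioo (-(1 / 1000000)) 0 ×ˢ
      (Metric.ball 0 (1 / 1000000000) ×ˢ Metric.ball 0 (1 / 1000)) := by
    rw [interior_kinCyl]; norm_num
  have hPe : pastCyl d (1 / 1000) = Ioo (-3 / 1000000) (-2 / 1000000) ×ˢ
      (Metric.ball 0 (1 / 1000000000) ×ˢ Metric.ball 0 (1 / 1000)) := by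
    rw [pastCyl]; norm_num
  set V₁ := volume.real (interior (kinCyl d (1 / 1000))) with hV₁
  set V₂ := volume.real (pastCyl d (1 / 1000)) with hV₂
  set C₁ := volume.real (Metric.ball (0 : Vel d × Vel d) 1) *
    (c₀ * (6 + 20 / (3 * (1 / 4000000))) + 3 * (1 / 4000000) *
      (c₁ * (3 * (1 / 4000000) + 5)) * Λ) with hC₁
  set C₂ := ka * kb' * Λ + d * (ka' * kZ) with hC₂
  have hC₁0 : 0 ≤ C₁ := by positivity
  have hC₂0 : 0 ≤ C₂ := by positivity
  refine ⟨V₂ * C₁ + V₁ * V₂ * C₂ + V₁ * C₁, by positivity, ?_⟩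
  intro A f g hA hf ψ χ hψ hψc hψs hψ0 hψ1 hχ hχc hχs hχ0 hχ1
  rw [hQe] at hψs
  rw [hPe] at hχs
  have hζ_le : ∀ p, ζ p ≤ c₀ := fun p => (le_abs_self _).trans (hc₀ p)
  have hspace : ∀ {S' : ℝ} {I : Set ℝ} {η : Phase d → ℝ}, |S'| = 1 / 4000000 →
      tsupport η ⊆ I ×ˢ (Metric.ball 0 (1 / 1000000000) ×ˢ Metric.ball 0 (1 / 1000)) →
      (∀ σ ∈ Icc (0 : ℝ) 1, ∀ t, t + S' * σ ^ 3 ∈ I → t ∈ Ioo (-1 : ℝ) 0) →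
      ∀ σ ∈ Icc (0 : ℝ) 1, ∀ w z, startPt S' σ w z ∈ tsupport η →
        endPt S' w (startPt S' σ w z) ∈ tsupport ζ → z ∈ U ∧ w ∈ Metric.ball 0 1 := by
    intro S' I η hS' hη hI σ hσ w z h1 h2
    have m1 := hη h1
    have m2 := hζt h2
    simp only [mem_prod, mem_ball_zero_iff, mem_closedBall_zero_iff] at m1 m2
    obtain ⟨r1, r2, r3⟩ := norm_lt_one_of_startPt_endPt hS' hσ m1.2.1.le m1.2.2.le m2.1 m2.2
    refine ⟨?_, r3⟩
    rw [hUe]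
    exact ⟨hI σ hσ z.1 m1.1, mem_ball_zero_iff.2 r1, mem_ball_zero_iff.2 r2⟩
  have cube : ∀ σ ∈ Icc (0 : ℝ) 1, 0 ≤ σ ^ 3 ∧ σ ^ 3 ≤ 1 := fun σ hσ =>
    ⟨pow_nonneg hσ.1 3, pow_le_one₀ hσ.1 hσ.2⟩
  -- The trajectories leave the support of `ψ` backward in time (`S`) and that of `χ` forward in
  -- time (`-S`), so that the two inequalities point in directions that can be chained.
  have b1 := bridge_inequality hU hUm hA hf hψ hψc hζ hS0 hψ0 hψ1 hζ0 hζ_le hc₁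
    (hspace hSabs hψs fun σ hσ t ht => by
      have := cube σ hσ
      rw [hS] at ht
      constructor <;> linarith [ht.1, ht.2])
  have b2 := bridge_inequality hU hUm hA hf hχ hχc hζ (neg_ne_zero.2 hS0) hχ0 hχ1 hζ0 hζ_le hc₁
    (hspace hSabs' hχs fun σ hσ t ht => by
      have := cube σ hσ
      rw [hS] at ht
      constructor <;> linarith [ht.1, ht.2])
  rw [hSabs, ← hC₁] at b1
  rw [hSabs', ← hC₁] at b2
  rw [show (1 / 4000000 : ℝ) / S = 1 by rw [hS]; norm_num, one_mul] at b1
  rw [show (1 / 4000000 : ℝ) / -S = -1 by rw [hS]; norm_num] at b2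
  have hψi : Integrable ψ := hψ.continuous.integrable_of_hasCompactSupport hψc
  have hχi : Integrable χ := hχ.continuous.integrable_of_hasCompactSupport hχc
  set P := ∫ z, ψ z with hP
  set Q := ∫ z, χ z with hQ
  have hP0 : 0 ≤ P := integral_nonneg hψ0
  have hQ0 : 0 ≤ Q := integral_nonneg hχ0
  have hPV : P ≤ V₁ := by
    refine integral_le_measureReal (by rwa [hQe]) ?_ hψi hψ1
    rw [hQe]
    exact ((Metric.isBounded_Ioo _ _).prod
      (Metric.isBounded_ball.prod Metric.isBounded_ball)).measure_lt_top.ne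
  have hQV : Q ≤ V₂ := by
    refine integral_le_measureReal (by rwa [hPe]) ?_ hχi hχ1
    rw [hPe]
    exact ((Metric.isBounded_Ioo _ _).prod
      (Metric.isBounded_ball.prod Metric.isBounded_ball)).measure_lt_top.ne
  have hpP : ∫ t, timeMarginal ψ (t + S) = P := by
    rw [integral_add_right_eq_self (timeMarginal ψ) S, integral_timeMarginal hψi]
  have hqQ : ∫ t, timeMarginal χ (t + -S) = Q := by
    rw [integral_add_right_eq_self (timeMarginal χ) (-S), integral_timeMarginal hχi]
  -- In units of `r²` the marginal of `ψ` now lives in `(-5/4, -1/4)` and that of `χ` in `(-11/4,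
  -- -7/4)`; the separating time is `-3/2`.
  obtain ⟨k, hk, hkd, hk0, hkle, hks⟩ := exists_time_profile
    (p := fun t => timeMarginal ψ (t + S)) (q := fun t => timeMarginal χ (t + -S))
    (α := -3 / 1000000) (τ := -3 / 2000000) (β := -1 / 4000000)
    ((contDiff_timeMarginal hψ hψc).comp (by fun_prop))
    ((contDiff_timeMarginal hχ hχc).comp (by fun_prop))
    (fun t => integral_nonneg fun _ => hψ0 _) (fun t => integral_nonneg fun _ => hχ0 _)
    (by norm_num) (by norm_num)
    (fun t ht => timeMarginal_eq_zero hψs fun h => ht (by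
      rw [hS] at h
      constructor <;> linarith [h.1, h.2]))
    (fun t ht => timeMarginal_eq_zero hχs fun h => ht (by
      rw [hS] at h
      constructor <;> linarith [h.1, h.2]))
  rw [hpP, hqQ] at hkle
  simp only [hpP, hqQ] at hkd
  have hsub : Icc (-3 / 1000000 : ℝ) (-1 / 4000000) ×ˢ
      (Metric.closedBall (0 : Vel d) (1 / 1000000000) ×ˢ
        Metric.closedBall (0 : Vel d) (1 / 1000)) ⊆ U := by
    rw [hUe]
    refine prod_mono (fun t ht => ?_) (prod_mono
      (Metric.closedBall_subset_ball (by norm_num)) (Metric.closedBall_subset_ball (by norm_num)))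
    constructor <;> linarith [ht.1, ht.2]
  have b3 := time_inequality hU hUm hA hf hk ha hb hZ hbZ hks has hbs hZs hsub hk0 ha0 hb0 hkle
    (c₁ := ka * kb') (c₂ := ka' * kZ)
    (fun x v => mul_le_mul ((le_abs_self _).trans (hka x)) (hkb' v) (norm_nonneg _) hka0)
    (fun x v => mul_le_mul (hka' x) (hkZ v) (abs_nonneg _) hka'0)
  rw [← hC₂] at b3
  have hmc : ∀ {η : Phase d → ℝ} (s : ℝ), ContDiff ℝ ∞ η → HasCompactSupport η →
      IntegrableOn (fun z => f z * (timeMarginal η (z.1 + s) * ζ z.2)) U := fun s h1 h2 => by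
    have := (contDiff_timeMarginal h1 h2).continuous
    have := hζ.continuous
    exact integrableOn_mul_continuous hU hUm hf.weakGrad.integrable_fun (by fun_prop)
  have e3 : -∫ z in U, f z * (deriv k z.1 * (a z.2.1 * b z.2.2)) =
      Q * (∫ z in U, f z * (timeMarginal ψ (z.1 + S) * ζ z.2)) -
        P * ∫ z in U, f z * (timeMarginal χ (z.1 + -S) * ζ z.2) := by
    rw [← integral_neg, ← integral_const_mul, ← integral_const_mul,
      ← integral_sub ((hmc S hψ hψc).const_mul Q) ((hmc (-S) hχ hχc).const_mul P)]
    refine integral_congr_ae (Filter.Eventually.of_forall fun z => ?_)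
    simp only [hkd, hζdef]
    ring
  rw [e3] at b3
  have hG : 0 ≤ ∫ z in U, ‖g z‖ := integral_nonneg fun _ => norm_nonneg _
  set G := ∫ z in U, ‖g z‖
  -- The chain is `ψ`, its shifted marginal, the shifted marginal of `χ`, and `χ`, with the weights
  -- `P` and `Q` making the masses comparable. Replacing `P`, `Q` in the errors by the volumes of
  -- the cylinders frees the constant from `ψ` and `χ`.
  have f1 := mul_le_mul_of_nonneg_left b1 hQ0
  have f2 := mul_le_mul_of_nonneg_left b2 hP0
  have f3 : Q * (C₁ * G) ≤ V₂ * (C₁ * G) := mul_le_mul_of_nonneg_right hQV (by positivity)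
  have f4 : P * (C₁ * G) ≤ V₁ * (C₁ * G) := mul_le_mul_of_nonneg_right hPV (by positivity)
  have f5 : P * Q * (C₂ * G) ≤ V₁ * V₂ * (C₂ * G) :=
    mul_le_mul_of_nonneg_right (mul_le_mul hPV hQV hQ0 (hP0.trans hPV)) (by positivity)
  linarith

/-- The positive part is integrated over a superlevel set. -/
theorem setIntegral_max_sub_eq {X : Type*} [MeasurableSpace X] {μ : Measure X} {U : Set X}
    {f : X → ℝ} (hf : IntegrableOn f U μ) (hU : MeasurableSet U) (hUf : μ U ≠ ⊤) (c : ℝ) :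
    ∃ E : Set X, MeasurableSet E ∧ E ⊆ U ∧
      ∫ z in U, max (f z - c) 0 ∂μ = (∫ z in E, f z ∂μ) - c * μ.real E := by
  -- The superlevel set is taken for a measurable representative, since `f` itself is only almost
  -- everywhere measurable.
  obtain ⟨f', hf', hff'⟩ := hf.aestronglyMeasurable
  have hSm : MeasurableSet {z | c < f' z} := measurableSet_lt measurable_const hf'.measurable
  refine ⟨U ∩ {z | c < f' z}, hU.inter hSm, inter_subset_left, ?_⟩
  have i1 : IntegrableOn f (U ∩ {z | c < f' z}) μ := hf.mono_set inter_subset_left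
  have i2 : IntegrableOn (fun _ => c) (U ∩ {z | c < f' z}) μ :=
    integrableOn_const (measure_ne_top_of_subset inter_subset_left hUf)
  have e1 : c * μ.real (U ∩ {z | c < f' z}) = ∫ _ in U ∩ {z | c < f' z}, c ∂μ := by
    simp [mul_comm]
  rw [e1, ← integral_sub i1 i2, ← setIntegral_indicator hSm]
  refine integral_congr_ae ?_
  filter_upwards [hff'] with z hz
  by_cases h : c < f' z
  · rw [indicator_of_mem (by exact h), max_eq_left (by rw [hz]; linarith)]
  · rw [indicator_of_notMem (by exact h), max_eq_right (by rw [hz]; linarith)]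

/-- **Kinetic Poincaré inequality.** -/
theorem theorem4p6 (d : ℕ) :
    ∃ r : ℝ, 0 < r ∧ r < 1 ∧ pastCyl d r ⊆ kinCyl d 1 ∧
      ∀ Λ : ℝ, 0 < Λ → ∃ C : ℝ, 0 < C ∧
        ∀ (A : Phase d → Matrix (Fin d) (Fin d) ℝ) (f : Phase d → ℝ)
          (g : Phase d → EuclideanSpace ℝ (Fin d)),
          IsBoundedCoeff (interior (kinCyl d 1)) Λ A →
          IsWeakSubsolution (interior (kinCyl d 1)) A f g →
          (∀ᵐ z ∂(volume.restrict (kinCyl d 1)), 0 ≤ f z) →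
          ∫ z in kinCyl d r, max (f z - ⨍ w in pastCyl d r, f w) 0 ≤
            C * ∫ z in kinCyl d 1, ‖g z‖ := by
  have hUe : interior (kinCyl d 1) = Ioo (-1) 0 ×ˢ (Metric.ball 0 1 ×ˢ Metric.ball 0 1) := by
    rw [interior_kinCyl]; norm_num
  have hPU : pastCyl d (1 / 1000) ⊆ interior (kinCyl d 1) := by
    rw [hUe, pastCyl]
    exact prod_mono (Ioo_subset_Ioo (by norm_num) (by norm_num))
      (prod_mono (Metric.ball_subset_ball (by norm_num)) (Metric.ball_subset_ball (by norm_num)))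
  have hQU : interior (kinCyl d (1 / 1000)) ⊆ interior (kinCyl d 1) := by
    rw [hUe, interior_kinCyl]
    exact prod_mono (Ioo_subset_Ioo (by norm_num) (by norm_num))
      (prod_mono (Metric.ball_subset_ball (by norm_num)) (Metric.ball_subset_ball (by norm_num)))
  have hPo : IsOpen (pastCyl d (1 / 1000)) :=
    isOpen_Ioo.prod (Metric.isOpen_ball.prod Metric.isOpen_ball)
  have hUf : volume (interior (kinCyl d 1)) ≠ ⊤ := by
    rw [hUe]
    exact ((Metric.isBounded_Ioo _ _).prod
      (Metric.isBounded_ball.prod Metric.isBounded_ball)).measure_lt_top.ne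
  have hPpos : 0 < volume.real (pastCyl d (1 / 1000)) := by
    refine ENNReal.toReal_pos (hPo.measure_pos volume ?_).ne' (measure_ne_top_of_subset hPU hUf)
    refine ⟨(-5 / 2000000, 0, 0), ?_⟩
    rw [pastCyl]
    refine ⟨by norm_num, ?_, ?_⟩ <;> simp
  refine ⟨1 / 1000, by norm_num, by norm_num, hPU.trans interior_subset, fun Λ hΛ => ?_⟩
  obtain ⟨M, hM, hM'⟩ := exists_comparison d
  obtain ⟨C, hC, hcomp⟩ := hM' Λ hΛ
  set V := volume.real (pastCyl d (1 / 1000)) with hV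
  refine ⟨C / (V * M) + 1, by positivity, fun A f g hA hf _ => ?_⟩
  have hfi := hf.weakGrad.integrable_fun
  rw [← setIntegral_congr_set (interior_kinCyl_ae_eq d (1 / 1000)),
    ← setIntegral_congr_set (interior_kinCyl_ae_eq d 1)]
  obtain ⟨E, hE, hEQ, hEeq⟩ := setIntegral_max_sub_eq (hfi.mono_set hQU)
    isOpen_interior.measurableSet (measure_ne_top_of_subset hQU hUf)
    (⨍ w in pastCyl d (1 / 1000), f w)
  rw [hEeq, setAverage_eq, ← hV, smul_eq_mul]
  obtain ⟨ψ, hψ, hψf, hψm⟩ := exists_smooth_approx_seq isOpen_interior hE hEQ hQU hUf hfi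
  obtain ⟨χ, hχ, hχf, hχm⟩ := exists_smooth_approx_seq hPo hPo.measurableSet Subset.rfl hPU hUf hfi
  -- In the limit `ψ` becomes the indicator of the superlevel set and `χ` that of the past cylinder,
  -- with the constant unchanged. Dividing by `V M` turns the mass of `f` in the past into its
  -- average times the volume of `E`.
  have hlim := le_of_tendsto_of_tendsto' (hχm.mul (hψf.const_mul M))
    ((hψm.mul (hχf.const_mul M)).add_const (C * ∫ z in interior (kinCyl d 1), ‖g z‖)) fun n =>
      hcomp A f g hA hf (ψ n) (χ n) (hψ n).1 (hψ n).2.1 (hψ n).2.2.1 (hψ n).2.2.2.1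
        (hψ n).2.2.2.2 (hχ n).1 (hχ n).2.1 (hχ n).2.2.1 (hχ n).2.2.2.1 (hχ n).2.2.2.2
  rw [← hV] at hlim
  have hG : 0 ≤ ∫ z in interior (kinCyl d 1), ‖g z‖ := integral_nonneg fun _ => norm_nonneg _
  have hfinal : (∫ z in E, f z) - V⁻¹ * (∫ z in pastCyl d (1 / 1000), f z) * volume.real E ≤
      C / (V * M) * ∫ z in interior (kinCyl d 1), ‖g z‖ := by
    rw [div_mul_eq_mul_div, le_div_iff₀ (by positivity)]
    have : ((∫ z in E, f z) - V⁻¹ * (∫ z in pastCyl d (1 / 1000), f z) * volume.real E) * (V * M) =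
        V * (M * ∫ z in E, f z) -
          volume.real E * (M * ∫ z in pastCyl d (1 / 1000), f z) := by
      field_simp
    rw [this]
    linarith
  linarith

end
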